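/- Let $K$ be an imaginary quadratic field with discriminant $D_K$, let $\mathcal O\subset K$ be an order of discriminant $D=D_Kc^2$, where $c\ge 1$ is the conductor of $\mathcal O$, and let $N\ge 1$ be an integer. Put $m=\gcd(N,c)$, $N_m=\prod_{p\mid m}p^{v_p(N)}$ (product over the primes $p$ dividing $m$) and $N'_m=N/N_m$. A \emph{Heegner point of level $N$ and discriminant $D$} is a point of $Y_0(N)(\mathbb C)$ associated to an isogeny $E\to E'$ of complex elliptic curves with cyclic kernel of order $N$ such that $\operatorname{End}(E)$ and $\operatorname{End}(E')$ are both isomorphic to the imaginary quadratic order of discriminant $D$. An \emph{admissible ideal of norm $M$} of $\mathcal O$ is an invertible ideal $I$ of $\mathcal O$ such that $\mathcal O/I\cong\mathbb Z/M\mathbb Z$ as additive groups. Then there exists a Heegner point of level $N$ and discriminant $D$ if and only if both of the following conditions hold: (a) every prime $p\mid N'_m$ is split or ramified in $K$, and is split in $K$ if $p^2\mid N$; (b) there exists an admissible ideal of norm $N_m$ in $\mathcal O$. -/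

import Mathlib

open scoped Topology nonZeroDivisors

namespace Heegner

noncomputable section

/-! ### Complex elliptic curves as complex tori -/

/-- The complex elliptic curve `ℂ / Λ`, where `Λ` is the lattice spanned by a pair of periods. -/
abbrev Curve (L : PeriodPair) : Type := ℂ ⧸ L.lattice

/-- The quotient map `ℂ → ℂ / Λ`. -/
abbrev toCurve (L : PeriodPair) (z : ℂ) : Curve L := Submodule.Quotient.mk z

/-- A map `ℂ / Λ → ℂ / Λ'` is holomorphic if, read in the charts given by the quotient maps,
it is holomorphic near every point: around each `z : ℂ` it lifts to an analytic function. -/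
def IsHolomorphic {L L' : PeriodPair} (f : Curve L → Curve L') : Prop :=
  ∀ z : ℂ, ∃ g : ℂ → ℂ, AnalyticAt ℂ g z ∧ ∀ᶠ w in 𝓝 z, toCurve L' (g w) = f (toCurve L w)

lemma IsHolomorphic.id (L : PeriodPair) : IsHolomorphic (fun x : Curve L => x) := fun _ =>
  ⟨fun w => w, analyticAt_id, Filter.Eventually.of_forall fun _ => rfl⟩

lemma IsHolomorphic.zero (L L' : PeriodPair) : IsHolomorphic (fun _ : Curve L => (0 : Curve L')) :=
  fun _ => ⟨fun _ => 0, analyticAt_const, Filter.Eventually.of_forall fun _ => rfl⟩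

lemma IsHolomorphic.neg {L L' : PeriodPair} {f : Curve L → Curve L'} (hf : IsHolomorphic f) :
    IsHolomorphic (fun x => -f x) := by
  intro z
  obtain ⟨g, hg, h⟩ := hf z
  exact ⟨fun w => -g w, hg.neg, h.mono fun w hw => by simp [← hw]⟩

lemma IsHolomorphic.add {L L' : PeriodPair} {f₁ f₂ : Curve L → Curve L'}
    (h₁ : IsHolomorphic f₁) (h₂ : IsHolomorphic f₂) : IsHolomorphic (fun x => f₁ x + f₂ x) := by
  intro z
  obtain ⟨g₁, hg₁, e₁⟩ := h₁ z
  obtain ⟨g₂, hg₂, e₂⟩ := h₂ z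
  refine ⟨fun w => g₁ w + g₂ w, hg₁.add hg₂, ?_⟩
  filter_upwards [e₁, e₂] with w hw₁ hw₂
  simp [← hw₁, ← hw₂]

lemma IsHolomorphic.comp {L L' L'' : PeriodPair} {f : Curve L' → Curve L''} {g : Curve L → Curve L'}
    (hf : IsHolomorphic f) (hg : IsHolomorphic g) : IsHolomorphic (fun x => f (g x)) := by
  intro z
  obtain ⟨u, hu, eu⟩ := hg z
  obtain ⟨v, hv, ev⟩ := hf (u z)
  refine ⟨fun w => v (u w), hv.comp hu, ?_⟩
  filter_upwards [eu, hu.continuousAt.eventually ev] with w hw hw'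
  rw [hw', hw]

/-- The endomorphism ring of `ℂ / Λ`: the holomorphic group endomorphisms, with pointwise addition
and with composition as multiplication. -/
def endRing (L : PeriodPair) : Subring (AddMonoid.End (Curve L)) where
  carrier := {f | IsHolomorphic f}
  mul_mem' hf hg := IsHolomorphic.comp hf hg
  one_mem' := IsHolomorphic.id L
  add_mem' hf hg := IsHolomorphic.add hf hg
  zero_mem' := IsHolomorphic.zero L L
  neg_mem' hf := IsHolomorphic.neg hf

/-- An isogeny `ℂ / Λ → ℂ / Λ'` with cyclic kernel of order `N`. -/
structure CyclicIsogeny (N : ℕ) (L L' : PeriodPair) where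
  toHom : Curve L →+ Curve L'
  holomorphic : IsHolomorphic toHom
  ne_zero : toHom ≠ 0
  cyclic_ker : IsAddCyclic toHom.ker
  card_ker : Nat.card toHom.ker = N

/-! ### The open modular curve -/

/-- The set of complex points of the modular curve `Y₀(N)`, as the quotient `Γ₀(N) \ ℍ`. -/
abbrev Y0 (N : ℕ) : Type := MulAction.orbitRel.Quotient (CongruenceSubgroup.Gamma0 N) UpperHalfPlane

/-- The pair of periods `(τ, 1)`, spanning the lattice `ℤ τ + ℤ`. -/
def periods (τ : UpperHalfPlane) : PeriodPair where
  ω₁ := τ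
  ω₂ := 1
  indep := by
    rw [LinearIndependent.pair_iff]
    intro s t h
    have him := congrArg Complex.im h
    have hre := congrArg Complex.re h
    have hs : s = 0 := by simpa [τ.im_ne_zero] using him
    subst hs
    exact ⟨rfl, by simpa using hre⟩

/-- The point of `Γ₀(N) \ ℍ` given by `τ` classifies the pair `(ℂ / (ℤ τ + ℤ), ⟨1 / N⟩)` up to
isomorphism. So a point `P` is the one associated with the elliptic curve `ℂ / Λ` and its subgroup
`C` if this pair is isomorphic to the pair of a representative `τ` of `P`. -/
def IsAssociated {N : ℕ} (P : Y0 N) (L : PeriodPair) (C : AddSubgroup (Curve L)) : Prop :=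
  ∃ τ : UpperHalfPlane, (Quotient.mk _ τ : Y0 N) = P ∧
    ∃ e : Curve L ≃+ Curve (periods τ), IsHolomorphic e ∧ IsHolomorphic e.symm ∧
      C.map e.toAddMonoidHom = AddSubgroup.zmultiples (toCurve (periods τ) (1 / (N : ℂ)))

/-! ### Orders and their discriminants -/

/-- An order of a number field `K`: a subring which is finitely generated as an abelian group
and which spans `K` over `ℚ`. -/
class IsOrder {K : Type*} [Field K] [NumberField K] (O : Subring K) : Prop where
  finite : Module.Finite ℤ O
  span_eq_top : Submodule.span ℚ (O : Set K) = ⊤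

instance {K : Type*} [Field K] [NumberField K] (O : Subring K) [IsOrder O] : Module.Finite ℤ O :=
  IsOrder.finite

/-- The discriminant of a commutative ring which is free of finite rank over `ℤ`
(it does not depend on the choice of the basis). -/
def ringDiscr (R : Type*) [CommRing R] [Module.Free ℤ R] [Module.Finite ℤ R] : ℤ :=
  Algebra.discr ℤ (Module.Free.chooseBasis ℤ R)

/-- The quadratic order of discriminant `D`, for an integer `D` which is `0` or `1` modulo `4`:
it is `ℤ[ω]` with `ω² = D / 4` if `D ≡ 0` and `ω² = ω + (D - 1) / 4` if `D ≡ 1` modulo `4`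
(here `D / 4` and `D % 4` are the quotient and remainder of `D` by `4`). -/
abbrev QuadraticOrder (D : ℤ) : Type := QuadraticAlgebra ℤ (D / 4) (D % 4)

/-- The ring `QuadraticOrder D` does have discriminant `D`. -/
theorem ringDiscr_quadraticOrder (D : ℤ) (hD : D % 4 = 0 ∨ D % 4 = 1) :
    ringDiscr (QuadraticOrder D) = D := by
  let b : Module.Basis (Fin 2) ℤ (QuadraticOrder D) := QuadraticAlgebra.basis _ _
  let b' := (Module.Free.chooseBasis ℤ (QuadraticOrder D)).reindex
    ((Module.Free.chooseBasis ℤ (QuadraticOrder D)).indexEquiv b)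
  have h : ringDiscr (QuadraticOrder D) = Algebra.discr ℤ b := by
    rw [Algebra.discr_eq_discr (QuadraticOrder D) b b', Module.Basis.coe_reindex,
      Algebra.discr_reindex]
    rfl
  have h0 : b 0 = ⟨1, 0⟩ := by
    apply b.repr.injective
    ext i
    fin_cases i <;> simp [b, -QuadraticAlgebra.basis_repr_apply] <;>
      simp [QuadraticAlgebra.basis_repr_apply]
  have h1 : b 1 = ⟨0, 1⟩ := by
    apply b.repr.injective
    ext i
    fin_cases i <;> simp [b, -QuadraticAlgebra.basis_repr_apply] <;>
      simp [QuadraticAlgebra.basis_repr_apply]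
  rw [h, Algebra.discr_def, Matrix.det_fin_two]
  simp only [Algebra.traceMatrix_apply, Algebra.traceForm_apply, Algebra.trace_eq_matrix_trace b,
    Matrix.trace_fin_two, Algebra.leftMulMatrix_eq_repr_mul, h0, h1]
  simp [b]
  have hdiv := Int.mul_ediv_add_emod D 4
  rcases hD with h | h <;> rw [h] at hdiv ⊢ <;> linarith

/-! ### Heegner points -/

/-- Heegner points of level `N` and discriminant `D`: points of `Y₀(N)` associated to an isogeny
`E → E'` with cyclic kernel of order `N` such that `End E` and `End E'` are both isomorphic
to the quadratic order of discriminant `D`. -/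
def IsHeegnerPoint (N : ℕ) (D : ℤ) (P : Y0 N) : Prop :=
  ∃ (L L' : PeriodPair) (φ : CyclicIsogeny N L L'),
    IsAssociated P L φ.toHom.ker ∧
    Nonempty (endRing L ≃+* QuadraticOrder D) ∧ Nonempty (endRing L' ≃+* QuadraticOrder D)

/-! ### Ideals and splitting of primes -/

/-- An admissible ideal of norm `M` of an order `O`: an invertible ideal `I` with
`O / I ≅ ℤ / M ℤ` as additive groups. -/
def IsAdmissible {O : Type*} [CommRing O] [IsDomain O] (M : ℕ) (I : Ideal O) : Prop :=
  IsUnit (I : FractionalIdeal O⁰ (FractionRing O)) ∧ Nonempty ((O ⧸ I) ≃+ ZMod M)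

/-- The prime `p` splits in the quadratic field `K`. -/
def SplitIn (p : ℕ) (K : Type*) [Field K] [NumberField K] : Prop :=
  ∃ P Q : Ideal (NumberField.RingOfIntegers K), P.IsPrime ∧ Q.IsPrime ∧ P ≠ Q ∧
    Ideal.span {(p : NumberField.RingOfIntegers K)} = P * Q

/-- The prime `p` ramifies in the quadratic field `K`. -/
def RamifiedIn (p : ℕ) (K : Type*) [Field K] [NumberField K] : Prop :=
  ∃ P : Ideal (NumberField.RingOfIntegers K), P.IsPrime ∧
    Ideal.span {(p : NumberField.RingOfIntegers K)} = P ^ 2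

/-- `N_m = ∏_{p ∣ m} p ^ v_p(N)`, the part of `N` supported at the primes dividing `m`. -/
def levelPart (N m : ℕ) : ℕ := ∏ p ∈ m.primeFactors, p ^ padicValNat p N

end

end Heegner

namespace Heegner

/-! Both sides reduce to one congruence condition, `HasPrimitiveRoot`. Let f be the minimal
polynomial of ω. A solution f(x) = N g gives the form (N, b, g) of discriminant D, where b = 2x - D
% 4, and the root is primitive exactly when this form is.

Heegner points: a holomorphic homomorphism of complex tori is a multiplication
(`exists_apply_eq_toCurve_mul`), so End(ℂ/Λ) is the multiplier ring of Λ. For ℤτ + ℤ it is the order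
of discriminant D exactly when τ is a root of a primitive form of discriminant D
(`exists_form_of_equiv`, `exists_equiv_of_form`). Comparing the forms of τ and Nτ, up to sign they
are (a₁N, b, c) and (a₁, b, Nc), and (N, b, ±a₁c) is then primitive; conversely a root of (N, b, g)
is a Heegner point.

Admissible ideals: an ideal with cyclic quotient of order M is (M, ω - x) with M ∣ f(x), and it is
invertible exactly when x is a primitive root (`exists_isAdmissible_quadraticOrder_iff`).

By the Chinese remainder theorem the condition at N splits into one at N_m, which is (b), and one at
N'_m. The latter is prime to c, where the order is maximal, so Hensel lifting and the factorization
of f modulo p turn it into (a) (`hasPrimitiveRoot_iff_split`). -/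

/-- The norm of `x - ω` in `QuadraticOrder D`: the minimal polynomial of `ω`, evaluated at `x`. -/
def omegaPoly (D x : ℤ) : ℤ := x ^ 2 - (D % 4) * x - D / 4

/-- `N` divides the norm of `x - ω`, and no prime divides `N`, the trace and the cofactor. -/
def IsPrimitiveRootMod (N D x : ℤ) : Prop :=
  ∃ g : ℤ, omegaPoly D x = N * g ∧
    ∀ p : ℕ, p.Prime → (p : ℤ) ∣ N → (p : ℤ) ∣ 2 * x - D % 4 → ¬ (p : ℤ) ∣ g

/-- The minimal polynomial of `ω` has a primitive root modulo `N`. -/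
def HasPrimitiveRoot (N D : ℤ) : Prop := ∃ x, IsPrimitiveRootMod N D x

lemma exists_bezout_of_forall_prime {a b c : ℤ}
    (h : ∀ p : ℕ, p.Prime → (p : ℤ) ∣ a → (p : ℤ) ∣ b → ¬ (p : ℤ) ∣ c) :
    ∃ u v w : ℤ, u * a + v * b + w * c = 1 := by
  have h1 : Int.gcd (Int.gcd a b) c = 1 := by
    by_contra hne
    obtain ⟨p, hp, hd⟩ := Nat.exists_prime_and_dvd hne
    have hd' : (p : ℤ) ∣ (Int.gcd (Int.gcd a b) c : ℕ) := by exact_mod_cast hd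
    have h2 := hd'.trans (Int.gcd_dvd_left _ _)
    exact h p hp (h2.trans (Int.gcd_dvd_left _ _)) (h2.trans (Int.gcd_dvd_right _ _))
      (hd'.trans (Int.gcd_dvd_right _ _))
  have e1 := Int.gcd_eq_gcd_ab (Int.gcd a b) c
  have e2 := Int.gcd_eq_gcd_ab a b
  rw [h1, e2] at e1
  refine ⟨Int.gcdA a b * Int.gcdA (Int.gcd a b) c, Int.gcdB a b * Int.gcdA (Int.gcd a b) c,
    Int.gcdB (Int.gcd a b) c, ?_⟩
  rw [← e2] at e1
  have e3 : ((1 : ℕ) : ℤ) = 1 := rfl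
  rw [e3] at e1
  linear_combination -e1 - (Int.gcdA (Int.gcd a b) c) * e2

/-! ### Ideals with cyclic quotient and their invertibility -/

section Ideals

variable {D : ℤ}

open QuadraticAlgebra

/-- The ideal `(M, ω - x)` of the quadratic order of discriminant `D`. -/
def rootIdeal (D M x : ℤ) : Ideal (QuadraticOrder D) :=
  Ideal.span {(M : QuadraticOrder D), ⟨-x, 1⟩}

/-- The ideal is the kernel of ω ↦ x modulo M, which is a ring homomorphism because M divides the
minimal polynomial at x. -/
lemma mem_rootIdeal {M x : ℤ} (h : M ∣ omegaPoly D x) (z : QuadraticOrder D) :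
    z ∈ rootIdeal D M x ↔ M ∣ z.re + z.im * x := by
  rw [rootIdeal, Ideal.mem_span_pair]
  constructor
  · rintro ⟨a, b, rfl⟩
    obtain ⟨g, hg⟩ := h
    refine ⟨a.re + a.im * x - b.im * g, ?_⟩
    simp only [omegaPoly] at hg
    simp
    linear_combination -b.im * hg
  · rintro ⟨k, hk⟩
    refine ⟨k, z.im, ?_⟩
    ext <;> simp
    linear_combination -hk

/-- The product with the conjugate ideal is M · (M, 2x - D % 4, g), and the Bézout relation makes
the second factor the unit ideal. -/
lemma rootIdeal_mul_rootIdeal {M x g u v w : ℤ} (hg : omegaPoly D x = M * g)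
    (h : u * M + v * (2 * x - D % 4) + w * g = 1) :
    rootIdeal D M x * rootIdeal D M (D % 4 - x) = Ideal.span {(M : QuadraticOrder D)} := by
  simp only [omegaPoly] at hg
  apply le_antisymm
  · rw [rootIdeal, rootIdeal, Ideal.span_pair_mul_span_pair, Ideal.span_le]
    rintro z (rfl | rfl | rfl | rfl) <;> rw [SetLike.mem_coe, Ideal.mem_span_singleton]
    · exact dvd_mul_right _ _
    · exact dvd_mul_right _ _
    · exact dvd_mul_left _ _
    · refine ⟨((-g : ℤ) : QuadraticOrder D), ?_⟩
      ext <;> simp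
      · linear_combination -hg
      · ring
  · rw [Ideal.span_singleton_le_iff_mem]
    have hM : ∀ y, (M : QuadraticOrder D) ∈ rootIdeal D M y :=
      fun y => Ideal.subset_span (by simp)
    have hω : ∀ y, (⟨-y, 1⟩ : QuadraticOrder D) ∈ rootIdeal D M y :=
      fun y => Ideal.subset_span (by simp)
    -- M times the Bézout relation: the two mixed products differ by M(2x - D % 4), and the product
    -- of the conjugates ω - x and ω - (D % 4 - x) is -M g.
    have key : (M : QuadraticOrder D) = (u : QuadraticOrder D) * (M * M) +
        (-v : ℤ) * (⟨-x, 1⟩ * M) + (v : ℤ) * (M * ⟨-(D % 4 - x), 1⟩) +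
        (-w : ℤ) * (⟨-x, 1⟩ * ⟨-(D % 4 - x), 1⟩) := by
      ext <;> simp
      · linear_combination -M * h - w * hg
      · right; ring
    rw [key]
    exact add_mem (add_mem (add_mem (Ideal.mul_mem_left _ _ (Ideal.mul_mem_mul (hM _) (hM _)))
      (Ideal.mul_mem_left _ _ (Ideal.mul_mem_mul (hω _) (hM _))))
      (Ideal.mul_mem_left _ _ (Ideal.mul_mem_mul (hM _) (hω _))))
      (Ideal.mul_mem_left _ _ (Ideal.mul_mem_mul (hω _) (hω _)))

/-- The ring homomorphism to `ℤ / M ℤ` that maps `ω` to a root of its minimal polynomial. -/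
def rootHom (D : ℤ) (M : ℕ) (x : ℤ) (h : (M : ℤ) ∣ omegaPoly D x) :
    QuadraticOrder D →+* ZMod M :=
  (QuadraticAlgebra.lift (R := ℤ) (a := D / 4) (b := D % 4) (A := ZMod M) ⟨(x : ZMod M), by
    have := (ZMod.intCast_zmod_eq_zero_iff_dvd _ M).mpr h
    simp only [omegaPoly] at this
    push_cast at this
    simp only [zsmul_eq_mul]
    linear_combination this⟩ : QuadraticOrder D →ₐ[ℤ] ZMod M).toRingHom

lemma rootHom_apply {M : ℕ} {x : ℤ} (h : (M : ℤ) ∣ omegaPoly D x) (z : QuadraticOrder D) :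
    rootHom D M x h z = ((z.re + z.im * x : ℤ) : ZMod M) := by
  simp [rootHom, QuadraticAlgebra.lift]

lemma ker_rootHom {M : ℕ} {x : ℤ} (h : (M : ℤ) ∣ omegaPoly D x) :
    RingHom.ker (rootHom D M x h) = rootIdeal D M x := by
  ext z
  rw [RingHom.mem_ker, rootHom_apply, mem_rootIdeal h, ZMod.intCast_zmod_eq_zero_iff_dvd]

lemma rootHom_surjective {M : ℕ} {x : ℤ} (h : (M : ℤ) ∣ omegaPoly D x) :
    Function.Surjective (rootHom D M x h) := fun y => by
  obtain ⟨k, rfl⟩ := ZMod.intCast_surjective y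
  exact ⟨k, by simp⟩

lemma exists_quotient_rootIdeal_addEquiv {M : ℕ} {x : ℤ} (h : (M : ℤ) ∣ omegaPoly D x) :
    Nonempty ((QuadraticOrder D ⧸ rootIdeal D M x) ≃+ ZMod M) :=
  ⟨((Ideal.quotEquivOfEq (ker_rootHom h).symm).trans
    (RingHom.quotientKerEquivOfSurjective (rootHom_surjective h))).toAddEquiv⟩

lemma rootIdeal_isPrime {p : ℕ} (hp : p.Prime) {x : ℤ} (h : (p : ℤ) ∣ omegaPoly D x) :
    (rootIdeal D p x).IsPrime := by
  have := Fact.mk hp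
  rw [← ker_rootHom h]
  exact RingHom.ker_isPrime _

/-- Whatever kills 1 kills the whole ring, so 1 has additive order M and therefore generates. -/
lemma exists_intCast_of_addEquiv_zmod {R : Type*} [CommRing R] {M : ℕ} (hM : M ≠ 0)
    (φ : R ≃+ ZMod M) :
    (∀ z : R, ∃ k : ℤ, z = k) ∧ ∀ k : ℤ, (k : R) = 0 ↔ (M : ℤ) ∣ k := by
  have h0 : ∀ k : ℤ, φ k = k * φ 1 := fun k => by
    rw [← zsmul_one, map_zsmul, zsmul_eq_mul]
  have h1 : ∀ k : ℤ, (k : R) = 0 ↔ (M : ℤ) ∣ k := by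
    intro k
    constructor
    · intro hk
      have : (k : R) * φ.symm 1 = 0 := by rw [hk, zero_mul]
      rw [← zsmul_eq_mul, ← map_zsmul, EmbeddingLike.map_eq_zero_iff] at this
      rw [← ZMod.intCast_zmod_eq_zero_iff_dvd]
      simpa using this
    · intro hk
      have : (k : ZMod M) = 0 := (ZMod.intCast_zmod_eq_zero_iff_dvd _ M).mpr hk
      apply φ.injective
      rw [h0, this, zero_mul, map_zero]
  refine ⟨?_, h1⟩
  have hinj : Function.Injective (fun t : ZMod M => t * φ 1) := by
    intro s t hst
    obtain ⟨k, rfl⟩ := ZMod.intCast_surjective s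
    obtain ⟨l, rfl⟩ := ZMod.intCast_surjective t
    simp only [← h0] at hst
    have h2 := φ.injective hst
    have h3 : ((k - l : ℤ) : R) = 0 := by push_cast; rw [h2, sub_self]
    rw [h1, ← ZMod.intCast_zmod_eq_zero_iff_dvd] at h3
    push_cast at h3
    exact sub_eq_zero.mp h3
  have : NeZero M := ⟨hM⟩
  intro z
  obtain ⟨t, ht⟩ := Finite.surjective_of_injective hinj (φ z)
  obtain ⟨k, rfl⟩ := ZMod.intCast_surjective t
  exact ⟨k, φ.injective (by rw [← ht, h0])⟩

lemma exists_eq_rootIdeal {M : ℕ} (hM : M ≠ 0) (I : Ideal (QuadraticOrder D))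
    (φ : (QuadraticOrder D ⧸ I) ≃+ ZMod M) :
    ∃ x : ℤ, (M : ℤ) ∣ omegaPoly D x ∧ I = rootIdeal D M x := by
  obtain ⟨h1, h2⟩ := exists_intCast_of_addEquiv_zmod hM φ
  obtain ⟨x, hx⟩ := h1 (Ideal.Quotient.mk I ⟨0, 1⟩)
  have h3 : ∀ z : QuadraticOrder D, z ∈ I ↔ (M : ℤ) ∣ z.re + z.im * x := by
    intro z
    rw [← h2, ← Ideal.Quotient.eq_zero_iff_mem]
    have : z = (z.re : QuadraticOrder D) + z.im * ⟨0, 1⟩ := by ext <;> simp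
    conv_lhs => rw [this, map_add, map_mul, hx, map_intCast, map_intCast]
    push_cast
    rfl
  have h4 : (M : ℤ) ∣ omegaPoly D x := by
    have h5 : (⟨-x, 1⟩ : QuadraticOrder D) ∈ I := (h3 _).mpr (by simp)
    have h6 := (h3 _).mp (I.mul_mem_left ⟨-(D % 4 - x), 1⟩ h5)
    rw [← dvd_neg]
    have h7 : ((⟨-(D % 4 - x), 1⟩ * ⟨-x, 1⟩ : QuadraticOrder D)).re +
        ((⟨-(D % 4 - x), 1⟩ * ⟨-x, 1⟩ : QuadraticOrder D)).im * x = -omegaPoly D x := by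
      simp [omegaPoly]
      ring
    rwa [h7] at h6
  exact ⟨x, h4, Ideal.ext fun z => by rw [h3, mem_rootIdeal h4]⟩

/-- If p divided all three numbers, then (ω - x) I ⊆ p I for I = (M, ω - x). Multiplying by J and
cancelling a gives p ∣ ω - x, which fails in the coefficient of ω. -/
lemma not_dvd_of_rootIdeal_mul_eq_span [IsDomain (QuadraticOrder D)] {M x g : ℤ}
    (hg : omegaPoly D x = M * g) {J : Ideal (QuadraticOrder D)}
    {a : QuadraticOrder D} (ha : a ≠ 0) (hJ : rootIdeal D M x * J = Ideal.span {a})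
    (p : ℕ) (hp : p.Prime) (hpM : (p : ℤ) ∣ M) (hpx : (p : ℤ) ∣ 2 * x - D % 4) : ¬ (p : ℤ) ∣ g := by
  rintro hpg
  obtain ⟨M', rfl⟩ := hpM
  obtain ⟨t, ht⟩ := hpx
  obtain ⟨g', rfl⟩ := hpg
  simp only [omegaPoly] at hg
  set M := (p : ℤ) * M' with hM
  have h1 : Ideal.span {(⟨-x, 1⟩ : QuadraticOrder D)} * rootIdeal D M x ≤
      Ideal.span {((p : ℤ) : QuadraticOrder D)} * rootIdeal D M x := by
    have hω : (⟨-x, 1⟩ : QuadraticOrder D) ∈ rootIdeal D M x := Ideal.subset_span (by simp)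
    have hM' : ((M : ℤ) : QuadraticOrder D) ∈ rootIdeal D M x := Ideal.subset_span (by simp)
    nth_rw 1 [rootIdeal]
    rw [Ideal.span_mul_span', Ideal.span_le, Set.singleton_mul]
    rintro _ ⟨z, rfl | rfl, rfl⟩
    · rw [SetLike.mem_coe, Ideal.mem_span_singleton_mul]
      refine ⟨_, Ideal.mul_mem_left _ (M' : QuadraticOrder D) hω, ?_⟩
      ext
      · simp [hM]
        ring
      · simp [hM]
    · rw [SetLike.mem_coe, Ideal.mem_span_singleton_mul]
      refine ⟨_, add_mem (Ideal.mul_mem_left _ ((-t : ℤ) : QuadraticOrder D) hω)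
        (Ideal.mul_mem_left _ ((-g' : ℤ) : QuadraticOrder D) hM'), ?_⟩
      ext <;> simp
      · linear_combination hg - x * ht
      · linear_combination ht
  have h2 := Ideal.mul_mono_left (K := J) h1
  rw [mul_assoc, mul_assoc, hJ, Ideal.span_singleton_mul_span_singleton,
    Ideal.span_singleton_mul_span_singleton, Ideal.span_singleton_le_span_singleton] at h2
  obtain ⟨y, hy⟩ := h2
  have h3 : (⟨-x, 1⟩ : QuadraticOrder D) = ((p : ℤ) : QuadraticOrder D) * y :=
    mul_right_cancel₀ ha (by rw [hy]; ring)
  have h4 := congrArg QuadraticAlgebra.im h3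
  simp at h4
  have : (p : ℤ) ∣ 1 := ⟨_, h4⟩
  exact hp.one_lt.ne' (by exact_mod_cast Int.eq_one_of_dvd_one (by positivity) this)

end Ideals

/-- Clearing denominators leaves an identity of integral ideals, easy to transport along ring
isomorphisms. -/
lemma isUnit_coeIdeal_iff {R : Type*} [CommRing R] [IsDomain R] (I : Ideal R) :
    IsUnit (I : FractionalIdeal R⁰ (FractionRing R)) ↔
      ∃ (J : Ideal R) (a : R), a ≠ 0 ∧ I * J = Ideal.span {a} := by
  constructor
  · intro h
    obtain ⟨I', hI'⟩ := h.exists_right_inv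
    obtain ⟨a, J, ha, rfl⟩ := FractionalIdeal.exists_eq_spanSingleton_mul I'
    refine ⟨J, a, ha, ?_⟩
    have ha' : algebraMap R (FractionRing R) a ≠ 0 := by simpa using ha
    have : (FractionalIdeal.spanSingleton R⁰ (algebraMap R (FractionRing R) a)) * 1 =
        (I * J : FractionalIdeal R⁰ (FractionRing R)) := by
      rw [← hI', mul_left_comm (I : FractionalIdeal R⁰ (FractionRing R)), ← mul_assoc,
        FractionalIdeal.spanSingleton_mul_spanSingleton, mul_inv_cancel₀ ha']
      simp
    rw [mul_one, ← FractionalIdeal.coeIdeal_span_singleton, ← FractionalIdeal.coeIdeal_mul,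
      FractionalIdeal.coeIdeal_inj] at this
    exact this.symm
  · rintro ⟨J, a, ha, h⟩
    have ha' : algebraMap R (FractionRing R) a ≠ 0 := by simpa using ha
    refine IsUnit.of_mul_eq_one (J * FractionalIdeal.spanSingleton R⁰
      (algebraMap R (FractionRing R) a)⁻¹) ?_
    rw [← mul_assoc, ← FractionalIdeal.coeIdeal_mul, h, FractionalIdeal.coeIdeal_span_singleton,
      FractionalIdeal.spanSingleton_mul_spanSingleton, mul_inv_cancel₀ ha']
    simp

lemma IsAdmissible.map {R S : Type*} [CommRing R] [IsDomain R] [CommRing S] [IsDomain S]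
    (e : R ≃+* S) {M : ℕ} {I : Ideal R} (h : IsAdmissible M I) :
    IsAdmissible M (I.map e) := by
  obtain ⟨h1, ⟨φ⟩⟩ := h
  rw [isUnit_coeIdeal_iff] at h1
  obtain ⟨J, a, ha, hJ⟩ := h1
  refine ⟨(isUnit_coeIdeal_iff _).mpr ⟨J.map e, e a, by simpa using ha, ?_⟩,
    ⟨(Ideal.quotientEquiv I (I.map e) e rfl).symm.toAddEquiv.trans φ⟩⟩
  rw [← Ideal.map_mul, hJ, Ideal.map_span, Set.image_singleton]

theorem exists_isAdmissible_quadraticOrder_iff {D : ℤ} [IsDomain (QuadraticOrder D)] {M : ℕ}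
    (hM : M ≠ 0) :
    (∃ I : Ideal (QuadraticOrder D), IsAdmissible M I) ↔ HasPrimitiveRoot M D := by
  constructor
  · rintro ⟨I, h1, ⟨φ⟩⟩
    obtain ⟨x, ⟨g, hg⟩, rfl⟩ := exists_eq_rootIdeal hM I φ
    obtain ⟨J, a, ha, hJ⟩ := (isUnit_coeIdeal_iff _).mp h1
    exact ⟨x, g, hg, not_dvd_of_rootIdeal_mul_eq_span hg ha hJ⟩
  · rintro ⟨x, g, hg, h⟩
    obtain ⟨u, v, w, huvw⟩ := exists_bezout_of_forall_prime h
    refine ⟨rootIdeal D M x, (isUnit_coeIdeal_iff _).mpr ⟨_, ((M : ℤ) : QuadraticOrder D), ?_,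
      rootIdeal_mul_rootIdeal hg huvw⟩, exists_quotient_rootIdeal_addEquiv ⟨g, hg⟩⟩
    exact_mod_cast hM

theorem exists_isAdmissible_iff {R : Type*} [CommRing R] [IsDomain R] {D : ℤ}
    (e : R ≃+* QuadraticOrder D) {M : ℕ} (hM : M ≠ 0) :
    (∃ I : Ideal R, IsAdmissible M I) ↔ HasPrimitiveRoot M D := by
  have : IsDomain (QuadraticOrder D) := e.symm.toMulEquiv.isDomain _
  rw [← exists_isAdmissible_quadraticOrder_iff hM]
  exact ⟨fun ⟨I, h⟩ => ⟨_, h.map e⟩, fun ⟨I, h⟩ => ⟨_, h.map e.symm⟩⟩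

/-! ### Quadratic rings are determined by their discriminant -/

lemma ringDiscr_eq_of_ringEquiv {R S : Type*} [CommRing R] [Module.Free ℤ R] [Module.Finite ℤ R]
    [CommRing S] [Module.Free ℤ S] [Module.Finite ℤ S] (e : R ≃+* S) :
    ringDiscr R = ringDiscr S := by
  let e' : R ≃ₐ[ℤ] S := AlgEquiv.ofRingEquiv (f := e) (by simp)
  let b := Module.Free.chooseBasis ℤ R
  let b' := (Module.Free.chooseBasis ℤ S)
  let b'' := b'.reindex (b'.indexEquiv (b.map e'.toLinearEquiv))
  have h1 : Algebra.discr ℤ b'' = Algebra.discr ℤ b' := by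
    rw [Module.Basis.coe_reindex, Algebra.discr_reindex]
  have h2 := Algebra.discr_eq_discr_of_algEquiv b e'
  rw [ringDiscr, ringDiscr, ← h1, h2]
  exact Algebra.discr_eq_discr S (b.map e'.toLinearEquiv) b''

/-- The vector 1 is primitive in the lattice: a common divisor g of its coordinates satisfies g² ∣
Norm(1) = 1. Hence 1 extends to a basis. -/
lemma exists_basis_one_add {R : Type*} [CommRing R] [Module.Free ℤ R] [Module.Finite ℤ R]
    (h : Module.finrank ℤ R = 2) : ∃ ω : R, ∀ z : R, ∃ x y : ℤ, z = x + y * ω := by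
  let b : Module.Basis (Fin 2) ℤ R := Module.finBasisOfFinrankEq ℤ R h
  obtain ⟨s, t, h1⟩ : ∃ s t : ℤ, (1 : R) = s * b 0 + t * b 1 :=
    ⟨b.repr 1 0, b.repr 1 1, by
      conv_lhs => rw [← b.sum_repr 1, Fin.sum_univ_two, zsmul_eq_mul, zsmul_eq_mul]⟩
  have h2 : IsCoprime s t := by
    rw [Int.isCoprime_iff_gcd_eq_one]
    obtain ⟨s', hs⟩ := Int.gcd_dvd_left s t
    obtain ⟨t', ht⟩ := Int.gcd_dvd_right s t
    set g : ℤ := ((Int.gcd s t : ℕ) : ℤ) with hg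
    have h3 : (1 : R) = algebraMap ℤ R g * (s' * b 0 + t' * b 1) := by
      rw [h1, hs, ht]
      simp
      ring
    have h4 := congrArg (Algebra.norm ℤ) h3
    rw [map_one, map_mul, Algebra.norm_algebraMap_of_basis b, Fintype.card_fin] at h4
    have h5 : g ∣ 1 := (dvd_pow_self g two_ne_zero).trans ⟨_, h4⟩
    have h6 := Int.eq_one_of_dvd_one (by positivity) h5
    rw [hg] at h6
    exact_mod_cast h6
  obtain ⟨α, β, h3⟩ := h2
  have h3' : (α : R) * s + β * t = 1 := by exact_mod_cast congrArg (Int.cast : ℤ → R) h3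
  -- With αs + βt = 1, this vector and 1 = s b₀ + t b₁ have determinant 1.
  refine ⟨-β * b 0 + α * b 1, fun z => ?_⟩
  refine ⟨b.repr z 0 * α + b.repr z 1 * β, b.repr z 1 * s - b.repr z 0 * t, ?_⟩
  conv_lhs => rw [← b.sum_repr z, Fin.sum_univ_two, zsmul_eq_mul, zsmul_eq_mul]
  push_cast
  linear_combination (-(b.repr z 0 : R) * b 0 - (b.repr z 1 : R) * b 1) * h3' -
    (b.repr z 0 * α + b.repr z 1 * β : R) * h1

theorem exists_ringEquiv_quadraticOrder {R : Type*} [CommRing R] [Module.Free ℤ R]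
    [Module.Finite ℤ R] (h : Module.finrank ℤ R = 2) :
    (ringDiscr R % 4 = 0 ∨ ringDiscr R % 4 = 1) ∧
      Nonempty (R ≃+* QuadraticOrder (ringDiscr R)) := by
  obtain ⟨ω, hω⟩ := exists_basis_one_add h
  obtain ⟨n, k, hnk⟩ := hω (ω * ω)
  -- Translating ω by l reduces its trace to 0 or 1, the normal form of `QuadraticOrder`.
  set l := k / 2
  set e := k % 2
  have hk : k = 2 * l + e := by omega
  set D := 4 * (n + l ^ 2 + e * l) + e with hD
  have he : e = 0 ∨ e = 1 := by omega
  have hD1 : D / 4 = n + l ^ 2 + e * l := by omega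
  have hD2 : D % 4 = e := by omega
  have hroot : (ω - l) * (ω - l) = (D / 4) • (1 : R) + (D % 4) • (ω - l) := by
    rw [hD1, hD2, zsmul_eq_mul, zsmul_eq_mul]
    have hk' : (k : R) = 2 * l + e := by rw [hk]; push_cast; ring
    push_cast
    linear_combination hnk + ω * hk'
  let f : QuadraticOrder D →ₐ[ℤ] R := QuadraticAlgebra.lift ⟨ω - l, hroot⟩
  have hf : Function.Surjective f := by
    intro z
    obtain ⟨x, y, rfl⟩ := hω z
    refine ⟨⟨x + y * l, y⟩, ?_⟩
    simp only [f, QuadraticAlgebra.lift, Equiv.coe_fn_mk, AlgHom.coe_mk, RingHom.coe_mk,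
      MonoidHom.coe_mk, OneHom.coe_mk, zsmul_eq_mul]
    push_cast
    ring
  have hfin : Module.finrank ℤ R = Module.finrank ℤ (QuadraticOrder D) := by
    rw [h, QuadraticAlgebra.finrank_eq_two]
  let φ : R ≃ₗ[ℤ] QuadraticOrder D := LinearEquiv.ofFinrankEq _ _ hfin
  have hinj : Function.Injective f := by
    have := OrzechProperty.injective_of_surjective_endomorphism (φ.toLinearMap ∘ₗ f.toLinearMap)
      (φ.surjective.comp hf)
    exact Function.Injective.of_comp this
  let E : QuadraticOrder D ≃+* R := RingEquiv.ofBijective f ⟨hinj, hf⟩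
  have hR : ringDiscr R = D := by
    rw [← ringDiscr_eq_of_ringEquiv E, ringDiscr_quadraticOrder D (by omega)]
  rw [hR]
  exact ⟨by omega, ⟨E.symm⟩⟩

section Orders

variable (K : Type*) [Field K] [NumberField K]

lemma finrank_of_isOrder [Algebra.IsQuadraticExtension ℚ K] (O : Subring K) [IsOrder O] :
    Module.finrank ℤ O = 2 := by
  let b := Module.Free.chooseBasis ℤ O
  let ι : O →ₗ[ℤ] K := O.subtype.toIntAlgHom.toLinearMap
  have h1 : LinearIndependent ℤ (ι ∘ b) :=
    b.linearIndependent.map' ι (LinearMap.ker_eq_bot.mpr Subtype.val_injective)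
  have h2 : LinearIndependent ℚ (ι ∘ b) := (LinearIndependent.iff_fractionRing ℤ ℚ).mp h1
  have h3 : ⊤ ≤ Submodule.span ℚ (Set.range (ι ∘ b)) := by
    rw [← IsOrder.span_eq_top (O := O), Submodule.span_le]
    intro z hz
    have h4 : (⟨z, hz⟩ : O) ∈ Submodule.span ℤ (Set.range b) := by rw [b.span_eq]; trivial
    have h5 := Submodule.mem_map_of_mem (f := ι) h4
    rw [Submodule.map_span, ← Set.range_comp] at h5
    exact Submodule.span_subset_span ℤ ℚ _ h5
  rw [Module.finrank_eq_card_basis b, ← Module.finrank_eq_card_basis (Module.Basis.mk h2 h3)]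
  exact Algebra.IsQuadraticExtension.finrank_eq_two ℚ K

lemma ringDiscr_ringOfIntegers :
    ringDiscr (NumberField.RingOfIntegers K) = NumberField.discr K := by
  rw [ringDiscr, NumberField.discr_eq_discr]

variable [Algebra.IsQuadraticExtension ℚ K]

lemma discr_neg [NumberField.IsTotallyComplex K] : NumberField.discr K < 0 := by
  have h1 := NumberField.sign_discr K
  have h2 := NumberField.IsTotallyComplex.finrank K
  rw [Algebra.IsQuadraticExtension.finrank_eq_two ℚ K] at h2
  have h3 : NumberField.InfinitePlace.nrComplexPlaces K = 1 := by omega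
  rw [h3, pow_one, Int.sign_eq_neg_one_iff_neg] at h1
  exact h1

end Orders

/-- Serves to exclude c = 0: for D = 0 the generator has square zero. -/
lemma not_isDomain_quadraticOrder_zero : ¬ IsDomain (QuadraticOrder 0) := by
  intro h
  have h1 : (⟨0, 1⟩ : QuadraticOrder 0) * ⟨0, 1⟩ = 0 := by ext <;> simp
  have h2 := congrArg QuadraticAlgebra.im (mul_self_eq_zero.mp h1)
  simp at h2

/-! ### Primitive roots, one prime at a time -/

section Arithmetic

variable {D : ℤ}

lemma omegaPoly_add (D x t : ℤ) :
    omegaPoly D (x + t) = omegaPoly D x + t * (2 * x - D % 4) + t ^ 2 := by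
  simp only [omegaPoly]
  ring

lemma four_mul_omegaPoly (hD : D % 4 = 0 ∨ D % 4 = 1) (x : ℤ) :
    4 * omegaPoly D x = (2 * x - D % 4) ^ 2 - D := by
  have h1 : (D % 4) ^ 2 = D % 4 := by rcases hD with h | h <;> rw [h] <;> rfl
  have h2 := Int.mul_ediv_add_emod D 4
  simp only [omegaPoly]
  linear_combination -h1 - h2

/-- A shift by a multiple of N² rather than N changes the cofactor g by a multiple of N, so g keeps
its residue at every prime dividing N. -/
lemma IsPrimitiveRootMod.add_sq_mul {N x : ℤ} (h : IsPrimitiveRootMod N D x) (s : ℤ) :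
    IsPrimitiveRootMod N D (x + N ^ 2 * s) := by
  obtain ⟨g, hg, hp⟩ := h
  refine ⟨g + N * s * (2 * x - D % 4) + N ^ 3 * s ^ 2, ?_, fun p hpp hN hx h => ?_⟩
  · rw [omegaPoly_add, hg]
    ring
  · obtain ⟨n, rfl⟩ := hN
    refine hp p hpp (dvd_mul_right _ _) ?_ ?_
    · obtain ⟨a, ha⟩ := hx
      exact ⟨a - 2 * p * n ^ 2 * s, by linear_combination ha⟩
    · obtain ⟨a, ha⟩ := h
      exact ⟨a - (n * s * (2 * x - D % 4) + p ^ 2 * n ^ 3 * s ^ 2), by linear_combination ha⟩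

lemma IsPrimitiveRootMod.mul {N₁ N₂ x : ℤ} (h : IsCoprime N₁ N₂) (h0₁ : N₁ ≠ 0) (h0₂ : N₂ ≠ 0)
    (h₁ : IsPrimitiveRootMod N₁ D x) (h₂ : IsPrimitiveRootMod N₂ D x) :
    IsPrimitiveRootMod (N₁ * N₂) D x := by
  obtain ⟨g₁, hg₁, hp₁⟩ := h₁
  obtain ⟨g₂, hg₂, hp₂⟩ := h₂
  obtain ⟨g, hg⟩ := h.mul_dvd ⟨g₁, hg₁⟩ ⟨g₂, hg₂⟩
  have e₁ : g₁ = N₂ * g := mul_left_cancel₀ h0₁ (by rw [← hg₁, hg]; ring)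
  have e₂ : g₂ = N₁ * g := mul_left_cancel₀ h0₂ (by rw [← hg₂, hg]; ring)
  refine ⟨g, hg, fun p hp hN hx hpg => ?_⟩
  rcases (Nat.prime_iff_prime_int.mp hp).dvd_or_dvd hN with hN' | hN'
  · exact hp₁ p hp hN' hx (e₁ ▸ dvd_mul_of_dvd_right hpg _)
  · exact hp₂ p hp hN' hx (e₂ ▸ dvd_mul_of_dvd_right hpg _)

lemma IsPrimitiveRootMod.of_mul_left {N₁ N₂ x : ℤ} (h : IsCoprime N₁ N₂)
    (hx : IsPrimitiveRootMod (N₁ * N₂) D x) : IsPrimitiveRootMod N₁ D x := by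
  obtain ⟨g, hg, hp⟩ := hx
  refine ⟨N₂ * g, by rw [hg, mul_assoc], fun p hpp hN hx hpg => ?_⟩
  rcases (Nat.prime_iff_prime_int.mp hpp).dvd_or_dvd hpg with h2 | h2
  · exact (Nat.prime_iff_prime_int.mp hpp).not_isUnit (h.isUnit_of_dvd' hN h2)
  · exact hp p hpp (dvd_mul_of_dvd_left hN _) hx h2

/-- Chinese remainder theorem, applied to the squares of the moduli so that both roots stay
primitive. -/
lemma hasPrimitiveRoot_mul_iff {N₁ N₂ : ℤ} (h : IsCoprime N₁ N₂) (h0₁ : N₁ ≠ 0) (h0₂ : N₂ ≠ 0) :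
    HasPrimitiveRoot (N₁ * N₂) D ↔ HasPrimitiveRoot N₁ D ∧ HasPrimitiveRoot N₂ D := by
  constructor
  · rintro ⟨x, hx⟩
    exact ⟨⟨x, IsPrimitiveRootMod.of_mul_left h hx⟩,
      ⟨x, IsPrimitiveRootMod.of_mul_left h.symm (by rw [mul_comm]; exact hx)⟩⟩
  · rintro ⟨⟨x₁, h₁⟩, ⟨x₂, h₂⟩⟩
    obtain ⟨u, v, huv⟩ := h.pow (m := 2) (n := 2)
    have e : x₁ + N₁ ^ 2 * (u * (x₂ - x₁)) = x₂ + N₂ ^ 2 * (v * (x₁ - x₂)) := by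
      linear_combination (x₂ - x₁) * huv
    refine ⟨x₁ + N₁ ^ 2 * (u * (x₂ - x₁)), IsPrimitiveRootMod.mul h h0₁ h0₂
      (IsPrimitiveRootMod.add_sq_mul h₁ _) ?_⟩
    rw [e]
    exact IsPrimitiveRootMod.add_sq_mul h₂ _

lemma hasPrimitiveRoot_one : HasPrimitiveRoot 1 D :=
  ⟨0, omegaPoly D 0, by ring, fun p hp h => absurd h fun h =>
    (Nat.prime_iff_prime_int.mp hp).not_isUnit (isUnit_of_dvd_one h)⟩

lemma hasPrimitiveRoot_iff_forall_prime {n : ℕ} (hn : n ≠ 0) :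
    HasPrimitiveRoot n D ↔
      ∀ p : ℕ, p.Prime → p ∣ n → HasPrimitiveRoot ((p : ℤ) ^ n.factorization p) D := by
  induction n using Nat.recOnPosPrimePosCoprime with
  | prime_pow q k hq hk =>
    constructor
    · intro h p hp hpn
      obtain rfl := (Nat.prime_dvd_prime_iff_eq hp hq).mp (hp.dvd_of_dvd_pow hpn)
      rw [hp.factorization_pow, Finsupp.single_eq_same]
      exact_mod_cast h
    · intro h
      have := h q hq (dvd_pow_self q hk.ne')
      rw [hq.factorization_pow, Finsupp.single_eq_same] at this
      exact_mod_cast this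
  | zero => exact absurd rfl hn
  | one =>
    refine ⟨fun _ p hp h => absurd (Nat.dvd_one.mp h) hp.ne_one, fun _ => ?_⟩
    exact_mod_cast hasPrimitiveRoot_one
  | coprime a b ha hb hab iha ihb =>
    have hc : IsCoprime (a : ℤ) b := Nat.isCoprime_iff_coprime.mpr hab
    rw [Nat.cast_mul, hasPrimitiveRoot_mul_iff hc (by positivity) (by positivity),
      iha (by positivity), ihb (by positivity)]
    have fa : ∀ p : ℕ, p.Prime → p ∣ a → (a * b).factorization p = a.factorization p := by
      intro p hp h
      exact Nat.factorization_eq_of_coprime_left hab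
        ((Nat.mem_primeFactorsList (by positivity)).mpr ⟨hp, h⟩)
    have fb : ∀ p : ℕ, p.Prime → p ∣ b → (a * b).factorization p = b.factorization p := by
      intro p hp h
      exact Nat.factorization_eq_of_coprime_right hab
        ((Nat.mem_primeFactorsList (by positivity)).mpr ⟨hp, h⟩)
    constructor
    · rintro ⟨h1, h2⟩ p hp hpn
      rcases (Nat.Prime.dvd_mul hp).mp hpn with h | h
      · rw [fa p hp h]; exact h1 p hp h
      · rw [fb p hp h]; exact h2 p hp h
    · intro h
      refine ⟨fun p hp hpa => ?_, fun p hp hpb => ?_⟩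
      · rw [← fa p hp hpa]; exact h p hp (dvd_mul_of_dvd_left hpa _)
      · rw [← fb p hp hpb]; exact h p hp (dvd_mul_of_dvd_right hpb _)

/-- Hensel lifting of a simple root; 2x - D % 4 is the derivative. -/
lemma exists_pow_dvd_omegaPoly {p : ℕ} (hp : p.Prime) {x : ℤ} (h : (p : ℤ) ∣ omegaPoly D x)
    (hx : ¬ (p : ℤ) ∣ 2 * x - D % 4) (k : ℕ) :
    ∃ y, (p : ℤ) ^ (k + 1) ∣ omegaPoly D y ∧ ¬ (p : ℤ) ∣ 2 * y - D % 4 := by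
  induction k with
  | zero => exact ⟨x, by simpa using h, hx⟩
  | succ k ih =>
    obtain ⟨y, ⟨g, hg⟩, hy⟩ := ih
    obtain ⟨u, v, huv⟩ := ((Nat.prime_iff_prime_int.mp hp).coprime_iff_not_dvd).mpr hy
    -- Newton correction, with v the inverse of the derivative modulo p.
    refine ⟨y + p ^ (k + 1) * (-g * v), ?_, fun h' => hy ?_⟩
    · rw [omegaPoly_add, hg]
      refine ⟨g * u + p ^ k * (-g * v) ^ 2, ?_⟩
      linear_combination (-p ^ (k + 1) * g : ℤ) * huv
    · obtain ⟨a, ha⟩ := h'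
      exact ⟨a - 2 * p ^ k * (-g * v), by linear_combination ha⟩

/-- The order of conductor c is generated by cω + s, where 2s = D' % 4 - c (D % 4) matches the
traces; it is an even number since D' ≡ cD modulo 2. -/
lemma exists_omegaPoly_conductor {D' c : ℤ} (hD : D % 4 = 0 ∨ D % 4 = 1)
    (hD' : D' % 4 = 0 ∨ D' % 4 = 1) (h : D' = D * c ^ 2) :
    ∃ s : ℤ, ∀ y : ℤ, omegaPoly D' (c * y + s) = c ^ 2 * omegaPoly D y ∧
      2 * (c * y + s) - D' % 4 = c * (2 * y - D % 4) := by
  have h1 : (2 : ℤ) ∣ D' % 4 - c * (D % 4) := by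
    have hpar : Even (D' - c * D) := by
      rw [h]
      have : D * c ^ 2 - c * D = D * (c * (c - 1)) := by ring
      rw [this]
      exact (Int.even_mul_pred_self c).mul_left D
    obtain ⟨t, ht⟩ := hpar
    have e1 := Int.mul_ediv_add_emod D 4
    have e2 := Int.mul_ediv_add_emod D' 4
    refine ⟨t - 2 * (D' / 4) + 2 * c * (D / 4), ?_⟩
    linear_combination ht + e2 - c * e1
  obtain ⟨s, hs⟩ := h1
  refine ⟨s, fun y => ?_⟩
  have h2 : 2 * (c * y + s) - D' % 4 = c * (2 * y - D % 4) := by linear_combination -hs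
  refine ⟨?_, h2⟩
  have h3 : 4 * omegaPoly D' (c * y + s) = 4 * (c ^ 2 * omegaPoly D y) := by
    rw [mul_left_comm, four_mul_omegaPoly hD, four_mul_omegaPoly hD', h2, h]
    ring
  linarith

/-- For a prime `p` prime to the conductor `c` and a discriminant `D` that is maximal at `p`. -/
lemma hasPrimitiveRoot_prime_pow_iff {D' c : ℤ} (hD : D % 4 = 0 ∨ D % 4 = 1)
    (hD' : D' % 4 = 0 ∨ D' % 4 = 1) (h : D' = D * c ^ 2) {p : ℕ} (hp : p.Prime)
    (hpc : ¬ (p : ℤ) ∣ c)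
    (hmax : ∀ y, (p : ℤ) ∣ 2 * y - D % 4 → ¬ (p : ℤ) ^ 2 ∣ omegaPoly D y) (k : ℕ) :
    HasPrimitiveRoot ((p : ℤ) ^ (k + 1)) D' ↔ (∃ y, (p : ℤ) ∣ omegaPoly D y) ∧
      (1 ≤ k → ∃ y, (p : ℤ) ∣ omegaPoly D y ∧ ¬ (p : ℤ) ∣ 2 * y - D % 4) := by
  obtain ⟨s, hs⟩ := exists_omegaPoly_conductor hD hD' h
  have hpp := Nat.prime_iff_prime_int.mp hp
  have hcop : IsCoprime (p : ℤ) c := (hpp.coprime_iff_not_dvd).mpr hpc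
  have hsplit : (∃ y, (p : ℤ) ∣ omegaPoly D y ∧ ¬ (p : ℤ) ∣ 2 * y - D % 4) →
      HasPrimitiveRoot ((p : ℤ) ^ (k + 1)) D' := by
    rintro ⟨y, hy, hy'⟩
    obtain ⟨x, ⟨g, hx⟩, hx'⟩ := exists_pow_dvd_omegaPoly (D := D') (x := c * y + s) hp
      (by rw [(hs y).1]; exact dvd_mul_of_dvd_right hy _)
      (by rw [(hs y).2]; exact fun h => (hpp.dvd_or_dvd h).elim hpc hy') k
    refine ⟨x, g, hx, fun q hq hqp hqx => ?_⟩
    have h1 : q ∣ p := hq.dvd_of_dvd_pow (n := k + 1) (by exact_mod_cast hqp)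
    obtain rfl := (Nat.prime_dvd_prime_iff_eq hq hp).mp h1
    exact absurd hqx hx'
  constructor
  · rintro ⟨x, g, hg, -⟩
    -- As v inverts c modulo p^(k+1), x is congruent to a point cy + s with y = v(x - s).
    obtain ⟨u, v, huv⟩ := hcop.pow_left (m := k + 1)
    have hxy : c * (v * (x - s)) + s = x + p ^ (k + 1) * (-u * (x - s)) := by
      linear_combination (x - s) * huv
    have h1 : (p : ℤ) ^ (k + 1) ∣ c ^ 2 * omegaPoly D (v * (x - s)) := by
      rw [← (hs _).1, hxy, omegaPoly_add, hg]
      exact ⟨g + -u * (x - s) * (2 * x - D' % 4) + p ^ (k + 1) * (-u * (x - s)) ^ 2, by ring⟩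
    have h2 : (p : ℤ) ^ (k + 1) ∣ omegaPoly D (v * (x - s)) :=
      (hcop.pow (m := k + 1) (n := 2)).dvd_of_dvd_mul_left h1
    have h3 : (p : ℤ) ∣ omegaPoly D (v * (x - s)) := (dvd_pow_self _ k.succ_ne_zero).trans h2
    -- For k ≥ 1 the root is one modulo p², so maximality prevents it from being double.
    refine ⟨⟨_, h3⟩, fun hk => ⟨_, h3, fun h4 => hmax _ h4 ?_⟩⟩
    exact (pow_dvd_pow _ (by omega)).trans h2
  · rintro ⟨⟨y, hy⟩, h2⟩
    by_cases hk : 1 ≤ k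
    · exact hsplit (h2 hk)
    -- A double root remains usable for k = 0: by maximality p does not divide its cofactor.
    by_cases hy' : (p : ℤ) ∣ 2 * y - D % 4
    · obtain rfl : k = 0 := by omega
      obtain ⟨g, hg⟩ := hy
      refine ⟨c * y + s, c ^ 2 * g, by rw [(hs y).1, hg]; ring, fun q hq hqp hqx hqg => ?_⟩
      have h1 : q ∣ p := hq.dvd_of_dvd_pow (n := 0 + 1) (by exact_mod_cast hqp)
      obtain rfl := (Nat.prime_dvd_prime_iff_eq hq hp).mp h1
      have h4 : (q : ℤ) ∣ g := (hcop.pow_right (n := 2)).dvd_of_dvd_mul_left hqg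
      refine hmax y hy' ?_
      rw [hg, sq]
      exact mul_dvd_mul_left _ h4
    · exact hsplit ⟨y, hy, hy'⟩

end Arithmetic

/-! ### Splitting and ramification read from roots modulo p -/

section Splitting

open QuadraticAlgebra

variable {D : ℤ}

/-- If p ∣ N(z) then p ∣ z: otherwise p does not divide z.im, and -z.re / z.im would be a root
modulo p. Primality follows from multiplicativity of the norm. -/
lemma span_isPrime_of_no_root {p : ℕ} (hp : p.Prime) (h : ∀ y, ¬ (p : ℤ) ∣ omegaPoly D y) :
    (Ideal.span {(p : QuadraticOrder D)}).IsPrime := by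
  have hpp := Nat.prime_iff_prime_int.mp hp
  have hmem : ∀ z : QuadraticOrder D,
      (p : ℤ) ∣ z.norm → z ∈ Ideal.span {(p : QuadraticOrder D)} := by
    intro z hz
    have hz' : (p : ℤ) ∣ z.re ^ 2 + (D % 4) * z.re * z.im - (D / 4) * z.im ^ 2 := by
      convert hz using 1
      rw [norm_def]
      ring
    have him : (p : ℤ) ∣ z.im := by
      by_contra hne
      obtain ⟨u, v, huv⟩ := (hpp.coprime_iff_not_dvd).mpr hne
      refine h (-(z.re * v)) ?_
      have e : omegaPoly D (-(z.re * v)) =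
          v ^ 2 * (z.re ^ 2 + (D % 4) * z.re * z.im - (D / 4) * z.im ^ 2) +
          p * (u * (D % 4 * z.re * v - D / 4 * (1 + v * z.im))) := by
        simp only [omegaPoly]
        linear_combination (-(D % 4) * z.re * v + D / 4 * (1 + v * z.im)) * huv
      rw [e]
      exact dvd_add (dvd_mul_of_dvd_right hz' _) (dvd_mul_right _ _)
    obtain ⟨t, ht⟩ := him
    have hre : (p : ℤ) ∣ z.re := by
      refine hpp.dvd_of_dvd_pow (n := 2) ?_
      have h1 : (p : ℤ) ∣ p * ((D % 4) * z.re * t - (D / 4) * (t * z.im)) := dvd_mul_right _ _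
      have h2 := dvd_sub hz' h1
      convert h2 using 1
      rw [ht]
      ring
    obtain ⟨s, hs⟩ := hre
    rw [Ideal.mem_span_singleton]
    exact ⟨⟨s, t⟩, by ext <;> simp [hs, ht]⟩
  refine ⟨?_, fun {a b} hab => ?_⟩
  · rw [Ne, Ideal.span_singleton_eq_top, isUnit_iff_norm_isUnit, QuadraticAlgebra.norm_natCast]
    intro h1
    exact hpp.not_isUnit (isUnit_of_dvd_unit (dvd_pow_self _ two_ne_zero) h1)
  · rw [Ideal.mem_span_singleton] at hab
    obtain ⟨y, hy⟩ := hab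
    have h1 : (p : ℤ) ∣ a.norm * b.norm := by
      rw [← map_mul, hy, map_mul, QuadraticAlgebra.norm_natCast]
      exact dvd_mul_of_dvd_left (dvd_pow_self _ two_ne_zero) _
    exact (hpp.dvd_or_dvd h1).imp (hmem a) (hmem b)

/-- Without a root (p) is prime, so it equals one of the factors; cancelling (p) makes the other the
unit ideal. -/
lemma exists_root_of_mul_eq_span [IsDomain (QuadraticOrder D)] {p : ℕ} (hp : p.Prime)
    {P Q : Ideal (QuadraticOrder D)} (hP : P.IsPrime) (hQ : Q.IsPrime)
    (h : Ideal.span {(p : QuadraticOrder D)} = P * Q) : ∃ y, (p : ℤ) ∣ omegaPoly D y := by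
  by_contra! hno
  have hprime := span_isPrime_of_no_root hp hno
  have h0 : (p : QuadraticOrder D) ≠ 0 := by exact_mod_cast hp.ne_zero
  have key : ∀ {P Q : Ideal (QuadraticOrder D)}, Q.IsPrime →
      Ideal.span {(p : QuadraticOrder D)} = P * Q →
      ¬ P ≤ Ideal.span {(p : QuadraticOrder D)} := by
    intro P Q hQ h hle
    have h1 : P = Ideal.span {(p : QuadraticOrder D)} :=
      le_antisymm hle (h.trans_le Ideal.mul_le_left)
    rw [h1] at h
    have h2 : Ideal.span {(p : QuadraticOrder D)} * ⊤ =
        Ideal.span {(p : QuadraticOrder D)} * Q := by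
      rw [← h, Ideal.mul_top]
    exact hQ.ne_top ((Ideal.span_singleton_mul_right_inj h0).mp h2).symm
  rcases (hprime.mul_le).mp h.ge with h1 | h1
  · exact key hQ h h1
  · exact key hP (by rw [h, mul_comm]) h1

lemma rootIdeal_eq_of_dvd {M x : ℤ} (hM : M ∣ omegaPoly D x) (h : M ∣ 2 * x - D % 4) :
    rootIdeal D M (D % 4 - x) = rootIdeal D M x := by
  have hM' : M ∣ omegaPoly D (D % 4 - x) := by
    convert hM using 1
    simp only [omegaPoly]
    ring
  ext z
  rw [mem_rootIdeal hM, mem_rootIdeal hM']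
  have e : z.re + z.im * (D % 4 - x) = z.re + z.im * x - z.im * (2 * x - D % 4) := by ring
  rw [e]
  exact dvd_sub_left (dvd_mul_of_dvd_right h _)

lemma exists_bezout_prime {p : ℕ} (hp : p.Prime) {b c : ℤ} (h : (p : ℤ) ∣ b → ¬ (p : ℤ) ∣ c) :
    ∃ u v w : ℤ, u * p + v * b + w * c = 1 :=
  exists_bezout_of_forall_prime fun q hq hqp hb hc => by
    obtain rfl := (Nat.prime_dvd_prime_iff_eq hq hp).mp (by exact_mod_cast hqp)
    exact h hb hc

/-- The prime `p` is the square of a prime ideal if `ω` has a double root modulo `p`,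
and the order is maximal at `p`. -/
lemma rootIdeal_sq {p : ℕ} (hp : p.Prime)
    (hmax : ∀ y, (p : ℤ) ∣ 2 * y - D % 4 → ¬ (p : ℤ) ^ 2 ∣ omegaPoly D y)
    {y : ℤ} (hy : (p : ℤ) ∣ omegaPoly D y) (hy' : (p : ℤ) ∣ 2 * y - D % 4) :
    Ideal.span {(p : QuadraticOrder D)} = rootIdeal D p y ^ 2 := by
  obtain ⟨g, hg⟩ := hy
  obtain ⟨u, v, w, h⟩ := exists_bezout_prime hp (b := 2 * y - D % 4) (c := g) fun _ hpg =>
    hmax y hy' (by rw [hg, sq]; exact mul_dvd_mul_left _ hpg)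
  have h1 := rootIdeal_mul_rootIdeal hg h
  rw [rootIdeal_eq_of_dvd ⟨g, hg⟩ hy', ← sq] at h1
  rw [h1, Int.cast_natCast]

/-- A simple root gives two distinct conjugate primes. A double root makes (p) the square of a
prime, which forces P = Q. -/
lemma exists_split_iff [IsDomain (QuadraticOrder D)] {p : ℕ} (hp : p.Prime)
    (hmax : ∀ y, (p : ℤ) ∣ 2 * y - D % 4 → ¬ (p : ℤ) ^ 2 ∣ omegaPoly D y) :
    (∃ P Q : Ideal (QuadraticOrder D), P.IsPrime ∧ Q.IsPrime ∧ P ≠ Q ∧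
      Ideal.span {(p : QuadraticOrder D)} = P * Q) ↔
    ∃ y, (p : ℤ) ∣ omegaPoly D y ∧ ¬ (p : ℤ) ∣ 2 * y - D % 4 := by
  have hpp := Nat.prime_iff_prime_int.mp hp
  constructor
  · rintro ⟨P, Q, hP, hQ, hne, h⟩
    obtain ⟨y, hy⟩ := exists_root_of_mul_eq_span hp hP hQ h
    refine ⟨y, hy, fun hy' => hne ?_⟩
    have hsq := rootIdeal_sq hp hmax hy hy'
    have hI := rootIdeal_isPrime hp hy
    have h0 : (p : QuadraticOrder D) ≠ 0 := by exact_mod_cast hp.ne_zero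
    have key : ∀ {P Q : Ideal (QuadraticOrder D)},
        Ideal.span {(p : QuadraticOrder D)} = P * Q → P.IsPrime → P ≤ rootIdeal D p y → P = Q := by
      intro P Q h hP hle
      have h1 : P = rootIdeal D p y := by
        refine le_antisymm hle (hP.le_of_pow_le (n := 2) ?_)
        rw [← hsq, h]
        exact Ideal.mul_le_left
      subst h1
      have hsq' := hsq.trans (sq _)
      have h2 := hsq'.symm.trans h
      -- Multiplying I·I = I·Q by I brings out the principal factor (p) = I², which can be
      -- cancelled.
      have h3 : Ideal.span {(p : QuadraticOrder D)} * rootIdeal D p y =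
          Ideal.span {(p : QuadraticOrder D)} * Q := by
        rw [hsq', mul_assoc, mul_assoc, h2]
      exact (Ideal.span_singleton_mul_right_inj h0).mp h3
    have hle : P * Q ≤ rootIdeal D p y := by
      rw [← h, hsq]
      exact Ideal.pow_le_self two_ne_zero
    rcases (hI.mul_le).mp hle with h1 | h1
    · exact key h hP h1
    · exact (key (by rw [h, mul_comm]) hQ h1).symm
  · rintro ⟨y, hy, hy'⟩
    have hy2 : (p : ℤ) ∣ omegaPoly D (D % 4 - y) := by
      convert hy using 1
      simp only [omegaPoly]
      ring
    obtain ⟨g, hg⟩ := hy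
    obtain ⟨u, v, w, h⟩ := exists_bezout_prime hp (b := 2 * y - D % 4) (c := g)
      fun h1 => absurd h1 hy'
    have h1 := rootIdeal_mul_rootIdeal hg h
    refine ⟨_, _, rootIdeal_isPrime hp ⟨g, hg⟩, rootIdeal_isPrime hp hy2, fun heq => hy' ?_,
      by rw [h1, Int.cast_natCast]⟩
    have h2 : (⟨-y, 1⟩ : QuadraticOrder D) ∈ rootIdeal D p (D % 4 - y) :=
      heq ▸ (mem_rootIdeal ⟨g, hg⟩ _).mpr (by simp)
    rw [mem_rootIdeal hy2] at h2
    obtain ⟨a, ha⟩ := h2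
    dsimp only at ha
    exact ⟨-a, by linear_combination -ha⟩

lemma exists_split_or_ramified_iff [IsDomain (QuadraticOrder D)] {p : ℕ} (hp : p.Prime)
    (hmax : ∀ y, (p : ℤ) ∣ 2 * y - D % 4 → ¬ (p : ℤ) ^ 2 ∣ omegaPoly D y) :
    ((∃ P Q : Ideal (QuadraticOrder D), P.IsPrime ∧ Q.IsPrime ∧ P ≠ Q ∧
        Ideal.span {(p : QuadraticOrder D)} = P * Q) ∨
      ∃ P : Ideal (QuadraticOrder D), P.IsPrime ∧
        Ideal.span {(p : QuadraticOrder D)} = P ^ 2) ↔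
    ∃ y, (p : ℤ) ∣ omegaPoly D y := by
  constructor
  · rintro (⟨P, Q, hP, hQ, -, h⟩ | ⟨P, hP, h⟩)
    · exact exists_root_of_mul_eq_span hp hP hQ h
    · exact exists_root_of_mul_eq_span hp hP hP (h.trans (sq P))
  · rintro ⟨y, hy⟩
    by_cases hy' : (p : ℤ) ∣ 2 * y - D % 4
    · exact Or.inr ⟨_, rootIdeal_isPrime hp hy, rootIdeal_sq hp hmax hy hy'⟩
    · exact Or.inl ((exists_split_iff hp hmax).mpr ⟨y, hy, hy'⟩)

lemma exists_split_map {R S : Type*} [CommRing R] [CommRing S] (e : R ≃+* S) {p : ℕ}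
    (h : ∃ P Q : Ideal R, P.IsPrime ∧ Q.IsPrime ∧ P ≠ Q ∧ Ideal.span {(p : R)} = P * Q) :
    ∃ P Q : Ideal S, P.IsPrime ∧ Q.IsPrime ∧ P ≠ Q ∧ Ideal.span {(p : S)} = P * Q := by
  obtain ⟨P, Q, hP, hQ, hne, h⟩ := h
  refine ⟨P.map e, Q.map e, Ideal.map_isPrime_of_equiv e, Ideal.map_isPrime_of_equiv e,
    fun h' => hne ?_, ?_⟩
  · have := congrArg (Ideal.comap e) h'
    rwa [Ideal.comap_map_of_bijective _ e.bijective,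
      Ideal.comap_map_of_bijective _ e.bijective] at this
  · rw [← Ideal.map_mul, ← h, Ideal.map_span, Set.image_singleton, map_natCast]

lemma exists_ramified_map {R S : Type*} [CommRing R] [CommRing S] (e : R ≃+* S) {p : ℕ}
    (h : ∃ P : Ideal R, P.IsPrime ∧ Ideal.span {(p : R)} = P ^ 2) :
    ∃ P : Ideal S, P.IsPrime ∧ Ideal.span {(p : S)} = P ^ 2 := by
  obtain ⟨P, hP, h⟩ := h
  exact ⟨P.map e, Ideal.map_isPrime_of_equiv e, by
    rw [← Ideal.map_pow, ← h, Ideal.map_span, Set.image_singleton, map_natCast]⟩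

variable {K : Type*} [Field K] [NumberField K]

/-- Maximality at p: otherwise (ω - y)/p is integral, a root of X² + tX + g, but has ω-coefficient
1/p. -/
lemma not_sq_dvd_omegaPoly (e : NumberField.RingOfIntegers K ≃+* QuadraticOrder D) {p : ℕ}
    (hp : p.Prime) (y : ℤ) (hy : (p : ℤ) ∣ 2 * y - D % 4) : ¬ (p : ℤ) ^ 2 ∣ omegaPoly D y := by
  rintro ⟨g, hg⟩
  obtain ⟨t, ht⟩ := hy
  have hp0 : (p : K) ≠ 0 := by exact_mod_cast hp.ne_zero
  set w := e.symm ⟨-y, 1⟩ with hw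
  have h1 : w * w = -((p * t : ℤ) : NumberField.RingOfIntegers K) * w -
      ((p ^ 2 * g : ℤ) : NumberField.RingOfIntegers K) := by
    apply e.injective
    rw [map_mul, map_sub, map_mul, map_neg, map_intCast, map_intCast, hw, e.apply_symm_apply,
      ← ht, ← hg]
    ext <;> simp [omegaPoly, sq] <;> ring
  have h2 : (w : K) * w = -(p * t) * w - p ^ 2 * g := by
    have := congrArg (algebraMap (NumberField.RingOfIntegers K) K) h1
    simpa using this
  have h3 : IsIntegral ℤ ((w : K) / p) := by
    refine ⟨Polynomial.X ^ 2 + Polynomial.C t * Polynomial.X + Polynomial.C g, ?_, ?_⟩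
    · monicity!
    · simp only [Polynomial.eval₂_add, Polynomial.eval₂_mul, Polynomial.eval₂_pow,
        Polynomial.eval₂_X, Polynomial.eval₂_C]
      simp only [eq_intCast]
      field_simp
      linear_combination h2
  obtain ⟨θ, hθ⟩ : ∃ θ : NumberField.RingOfIntegers K, algebraMap _ K θ = w / p := ⟨⟨_, h3⟩, rfl⟩
  have h4 : w = p * θ := by
    apply NumberField.RingOfIntegers.coe_injective
    rw [map_mul, map_natCast, hθ]
    field_simp
  have h5 := congrArg (fun z => (e z).im) h4
  simp [hw] at h5
  have h6 : (p : ℤ) ∣ 1 := ⟨_, h5⟩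
  exact (Nat.prime_iff_prime_int.mp hp).not_isUnit (isUnit_of_dvd_one h6)

lemma splitIn_iff (e : NumberField.RingOfIntegers K ≃+* QuadraticOrder D) {p : ℕ} (hp : p.Prime) :
    SplitIn p K ↔ ∃ y, (p : ℤ) ∣ omegaPoly D y ∧ ¬ (p : ℤ) ∣ 2 * y - D % 4 := by
  have : IsDomain (QuadraticOrder D) := e.symm.toMulEquiv.isDomain _
  rw [← exists_split_iff hp (not_sq_dvd_omegaPoly e hp)]
  exact ⟨exists_split_map e, exists_split_map e.symm⟩

lemma splitIn_or_ramifiedIn_iff (e : NumberField.RingOfIntegers K ≃+* QuadraticOrder D) {p : ℕ}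
    (hp : p.Prime) : SplitIn p K ∨ RamifiedIn p K ↔ ∃ y, (p : ℤ) ∣ omegaPoly D y := by
  have : IsDomain (QuadraticOrder D) := e.symm.toMulEquiv.isDomain _
  rw [← exists_split_or_ramified_iff hp (not_sq_dvd_omegaPoly e hp)]
  exact ⟨Or.imp (exists_split_map e) (exists_ramified_map e),
    Or.imp (exists_split_map e.symm) (exists_ramified_map e.symm)⟩

end Splitting

/-! ### The part of the level prime to m -/

lemma exists_levelPart_mul {N m : ℕ} (hN : N ≠ 0) (hm : m ∣ N) :
    ∃ B : ℕ, levelPart N m * B = N ∧ Nat.Coprime (levelPart N m) B ∧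
      ∀ p : ℕ, p.Prime → p ∣ B → ¬ p ∣ m := by
  have hsub : m.primeFactors ⊆ N.primeFactors := Nat.primeFactors_mono hm hN
  have hm0 : m ≠ 0 := ne_zero_of_dvd_ne_zero hN hm
  refine ⟨∏ p ∈ N.primeFactors \ m.primeFactors, p ^ padicValNat p N, ?_, ?_, ?_⟩
  · rw [levelPart, mul_comm, Finset.prod_sdiff hsub]
    conv_rhs => rw [← Nat.prod_factorization_pow_eq_self hN]
    rw [Nat.prod_factorization_eq_prod_primeFactors]
    refine Finset.prod_congr rfl fun p hp => ?_
    rw [Nat.factorization_def _ (Nat.prime_of_mem_primeFactors hp)]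
  · refine Nat.Coprime.prod_left fun p hp => Nat.Coprime.prod_right fun q hq => ?_
    rw [Finset.mem_sdiff] at hq
    refine Nat.coprime_pow_primes _ _ (Nat.prime_of_mem_primeFactors hp)
      (Nat.prime_of_mem_primeFactors hq.1) ?_
    rintro rfl
    exact hq.2 hp
  · intro p hp hpB hpm
    obtain ⟨q, hq, hpq⟩ := (hp.prime.dvd_finsetProd_iff _).mp hpB
    rw [Finset.mem_sdiff] at hq
    obtain rfl := (Nat.prime_dvd_prime_iff_eq hp (Nat.prime_of_mem_primeFactors hq.1)).mp
      (hp.dvd_of_dvd_pow hpq)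
    exact hq.2 (Nat.mem_primeFactors.mpr ⟨hp, hpm, hm0⟩)

/-! ### Homomorphisms of complex tori and multiplier rings -/

noncomputable section

lemma toCurve_eq_zero_iff {L : PeriodPair} {z : ℂ} : toCurve L z = 0 ↔ z ∈ L.lattice :=
  Submodule.Quotient.mk_eq_zero _

lemma toCurve_surjective (L : PeriodPair) : Function.Surjective (toCurve L) :=
  Submodule.Quotient.mk_surjective _

lemma eventually_eq_zero_of_mem_lattice (L : PeriodPair) :
    ∀ᶠ w in 𝓝 (0 : ℂ), w ∈ L.lattice → w = 0 := by
  filter_upwards [L.compl_lattice_sdiff_singleton_mem_nhds 0] with w hw h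
  by_contra h0
  exact hw ⟨h, h0⟩

/-- A function with `h (2 w) = 2 h w` near `0`, differentiable at `0`, is linear near `0`. -/
lemma exists_eq_mul_of_eq_two_mul {h : ℂ → ℂ} (hd : DifferentiableAt ℂ h 0) (h0 : h 0 = 0)
    {δ : ℝ} (hδ : ∀ w, ‖w‖ < δ → h w = 2 * h (w / 2)) :
    ∀ w, ‖w‖ < δ → h w = deriv h 0 * w := by
  intro w hw
  have h1 : ∀ n : ℕ, h w = 2 ^ n * h (w / 2 ^ n) := by
    intro n
    induction n with
    | zero => simp
    | succ n ih =>
      have h2 : ‖w / 2 ^ n‖ < δ := by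
        refine lt_of_le_of_lt ?_ hw
        rw [norm_div, norm_pow, Complex.norm_ofNat]
        exact div_le_self (norm_nonneg _) (one_le_pow₀ (by norm_num))
      rw [ih, hδ _ h2, pow_succ, div_div]
      ring
  -- The difference quotients of t ↦ h(tw) at t = 2⁻ⁿ all equal h(w), so h(w) is their limit.
  have h3 : HasDerivAt (fun t : ℂ => h (t * w)) (deriv h 0 * w) 0 := by
    have h4 : HasDerivAt h (deriv h 0) (0 * w) := by
      rw [zero_mul]
      exact hd.hasDerivAt
    have h5 : HasDerivAt (fun t : ℂ => t * w) w 0 := by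
      simpa using (hasDerivAt_id (0 : ℂ)).mul_const w
    exact h4.comp (0 : ℂ) h5
  have h6 : Filter.Tendsto (fun n : ℕ => ((1 / 2 : ℂ) ^ n)) Filter.atTop (𝓝[≠] 0) := by
    rw [tendsto_nhdsWithin_iff]
    exact ⟨tendsto_pow_atTop_nhds_zero_of_norm_lt_one (by norm_num),
      Filter.Eventually.of_forall fun n => by simp⟩
  have h7 := h3.tendsto_slope_zero.comp h6
  refine tendsto_nhds_unique (tendsto_const_nhds.congr fun n => ?_) h7
  simp only [Function.comp_apply, zero_add, zero_mul, h0, sub_zero, smul_eq_mul]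
  rw [h1 n, one_div, inv_pow, inv_inv, ← div_eq_inv_mul]

/-- A holomorphic homomorphism between complex tori is induced by a multiplication. -/
theorem exists_apply_eq_toCurve_mul {L L' : PeriodPair} (f : Curve L →+ Curve L')
    (hf : IsHolomorphic f) : ∃ α : ℂ, ∀ z, f (toCurve L z) = toCurve L' (α * z) := by
  obtain ⟨g, hg, hev⟩ := hf 0
  have hg0 : toCurve L' (g 0) = 0 := by
    rw [hev.self_of_nhds]
    exact map_zero f
  let h : ℂ → ℂ := fun w => g w - g 0
  have hd : DifferentiableAt ℂ h 0 := hg.differentiableAt.sub_const _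
  have h0 : h 0 = 0 := sub_self _
  have hev' : ∀ᶠ w in 𝓝 (0 : ℂ), toCurve L' (h w) = f (toCurve L w) := by
    filter_upwards [hev] with w hw
    rw [← hw, toCurve, Submodule.Quotient.mk_sub]
    exact (congrArg _ hg0).trans (sub_zero _)
  have hhalf : Filter.Tendsto (fun w : ℂ => w / 2) (𝓝 0) (𝓝 0) := by
    have : ContinuousAt (fun w : ℂ => w / 2) 0 := by fun_prop
    simpa [ContinuousAt] using this
  have hlim : Filter.Tendsto (fun w => h w - 2 * h (w / 2)) (𝓝 0) (𝓝 0) := by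
    have h1 : Filter.Tendsto h (𝓝 0) (𝓝 0) := by
      simpa [ContinuousAt, h0] using hd.continuousAt
    simpa using h1.sub ((h1.comp hhalf).const_mul 2)
  -- The difference lies in the lattice and tends to 0, so it vanishes near 0 by discreteness.
  have hdouble : ∀ᶠ w in 𝓝 (0 : ℂ), h w = 2 * h (w / 2) := by
    filter_upwards [hlim.eventually (eventually_eq_zero_of_mem_lattice L'), hev',
      hhalf.eventually hev'] with w h1 h2 h3
    refine sub_eq_zero.mp (h1 (toCurve_eq_zero_iff.mp ?_))
    have h4 : toCurve L' (2 * h (w / 2)) = f (toCurve L w) := by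
      have e1 : (2 : ℂ) * h (w / 2) = (2 : ℤ) • h (w / 2) := by simp
      rw [e1, toCurve, Submodule.Quotient.mk_smul]
      change (2 : ℤ) • toCurve L' (h (w / 2)) = _
      rw [h3, ← map_zsmul]
      change f (toCurve L ((2 : ℤ) • (w / 2))) = _
      congr 2
      simp only [zsmul_eq_mul, Int.cast_ofNat]
      ring
    rw [toCurve, Submodule.Quotient.mk_sub, sub_eq_zero]
    exact h2.trans h4.symm
  obtain ⟨δ, hδ, hball⟩ := Metric.eventually_nhds_iff.mp (hdouble.and hev')
  simp only [dist_zero_right] at hball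
  have hlin := exists_eq_mul_of_eq_two_mul hd h0 (δ := δ) fun w hw => (hball hw).1
  refine ⟨deriv h 0, fun z => ?_⟩
  -- Additivity of f extends the formula from a small disc to all of ℂ.
  obtain ⟨n, hn⟩ : ∃ n : ℕ, ‖z / 2 ^ n‖ < δ := by
    have h1 : Filter.Tendsto (fun n : ℕ => z * (1 / 2 : ℂ) ^ n) Filter.atTop (𝓝 0) := by
      simpa using (tendsto_pow_atTop_nhds_zero_of_norm_lt_one
        (by norm_num : ‖(1 / 2 : ℂ)‖ < 1)).const_mul z
    obtain ⟨n, hn⟩ := (h1.eventually (Metric.ball_mem_nhds 0 hδ)).exists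
    refine ⟨n, ?_⟩
    simpa [div_eq_mul_inv] using hn
  have e1 : ∀ y : ℂ, y = ((2 ^ n : ℕ) : ℤ) • (y / 2 ^ n) := fun y => by
    simp only [zsmul_eq_mul]
    push_cast
    field_simp
  have e2 : f (toCurve L (z / 2 ^ n)) = toCurve L' (deriv h 0 * z / 2 ^ n) := by
    rw [← (hball hn).2, hlin _ hn, mul_div_assoc]
  rw [e1 z]
  change f (((2 ^ n : ℕ) : ℤ) • toCurve L (z / 2 ^ n)) = _
  rw [map_zsmul, e2, ← e1 z]
  change toCurve L' (((2 ^ n : ℕ) : ℤ) • (deriv h 0 * z / 2 ^ n)) = _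
  rw [← e1]

lemma eq_zero_of_forall_mul_mem {L : PeriodPair} {α : ℂ} (h : ∀ z, α * z ∈ L.lattice) : α = 0 := by
  have h1 : Filter.Tendsto (fun z : ℂ => α * z) (𝓝[≠] 0) (𝓝 0) := by
    have : ContinuousAt (fun z : ℂ => α * z) 0 := by fun_prop
    have h2 : Filter.Tendsto (fun z : ℂ => α * z) (𝓝 0) (𝓝 0) := by
      simpa [ContinuousAt] using this
    exact h2.mono_left nhdsWithin_le_nhds
  obtain ⟨z, hz, hz0⟩ := ((h1.eventually (eventually_eq_zero_of_mem_lattice L)).and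
    self_mem_nhdsWithin).exists
  exact (mul_eq_zero.mp (hz (h z))).resolve_right hz0

/-- The homomorphism of complex tori induced by multiplication by `α`. -/
def mulHom {L L' : PeriodPair} (α : ℂ) (h : ∀ z ∈ L.lattice, α * z ∈ L'.lattice) :
    Curve L →+ Curve L' :=
  (Submodule.mapQ L.lattice L'.lattice (LinearMap.mulLeft ℤ α) h).toAddMonoidHom

lemma mulHom_apply {L L' : PeriodPair} {α : ℂ} (h : ∀ z ∈ L.lattice, α * z ∈ L'.lattice) (z : ℂ) :
    mulHom α h (toCurve L z) = toCurve L' (α * z) := rfl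

lemma isHolomorphic_mulHom {L L' : PeriodPair} {α : ℂ} (h : ∀ z ∈ L.lattice, α * z ∈ L'.lattice) :
    IsHolomorphic (mulHom α h) := fun _ =>
  ⟨fun w => α * w, analyticAt_const.mul analyticAt_id, Filter.Eventually.of_forall fun _ => rfl⟩

/-- The ring of complex multiplications of a lattice. -/
def mulRing (L : PeriodPair) : Subring ℂ where
  carrier := {α | ∀ z ∈ L.lattice, α * z ∈ L.lattice}
  mul_mem' ha hb z hz := by
    rw [mul_assoc]
    exact ha _ (hb z hz)
  one_mem' z hz := by rwa [one_mul]
  add_mem' ha hb z hz := by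
    rw [add_mul]
    exact add_mem (ha z hz) (hb z hz)
  zero_mem' z _ := by
    rw [zero_mul]
    exact zero_mem _
  neg_mem' ha z hz := by
    rw [neg_mul]
    exact neg_mem (ha z hz)

/-- The action of the ring of complex multiplications on the complex torus. -/
def mulRingHom (L : PeriodPair) : mulRing L →+* endRing L where
  toFun α := ⟨mulHom α.1 α.2, isHolomorphic_mulHom α.2⟩
  map_one' := by
    ext x
    obtain ⟨z, rfl⟩ := toCurve_surjective L x
    change toCurve L (1 * z) = toCurve L z
    rw [one_mul]
  map_mul' α β := by
    ext x
    obtain ⟨z, rfl⟩ := toCurve_surjective L x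
    change toCurve L ((α.1 * β.1) * z) = toCurve L (α.1 * (β.1 * z))
    rw [mul_assoc]
  map_zero' := by
    ext x
    obtain ⟨z, rfl⟩ := toCurve_surjective L x
    change toCurve L (0 * z) = 0
    rw [zero_mul]
    rfl
  map_add' α β := by
    ext x
    obtain ⟨z, rfl⟩ := toCurve_surjective L x
    change toCurve L ((α.1 + β.1) * z) = toCurve L (α.1 * z) + toCurve L (β.1 * z)
    rw [add_mul]
    rfl

lemma mulRingHom_bijective (L : PeriodPair) : Function.Bijective (mulRingHom L) := by
  constructor
  · rw [injective_iff_map_eq_zero]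
    intro α hα
    refine Subtype.ext (eq_zero_of_forall_mul_mem (L := L) fun z => toCurve_eq_zero_iff.mp ?_)
    exact DFunLike.congr_fun (congrArg Subtype.val hα) (toCurve L z)
  · rintro ⟨f, hf⟩
    obtain ⟨α, hα⟩ := exists_apply_eq_toCurve_mul f hf
    refine ⟨⟨α, fun z hz => ?_⟩, ?_⟩
    · rw [← toCurve_eq_zero_iff, ← hα, toCurve_eq_zero_iff.mpr hz]
      exact AddMonoidHom.map_zero (f : Curve L →+ Curve L)
    · ext x
      obtain ⟨z, rfl⟩ := toCurve_surjective L x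
      exact (hα z).symm

/-- The endomorphism ring of a complex torus is the ring of complex multiplications. -/
def endRingEquiv (L : PeriodPair) : mulRing L ≃+* endRing L :=
  RingEquiv.ofBijective _ (mulRingHom_bijective L)

lemma mulRing_eq_of_homothety {L L' : PeriodPair} {α : ℂ} (hα : α ≠ 0)
    (h : ∀ z, z ∈ L.lattice ↔ α * z ∈ L'.lattice) : mulRing L = mulRing L' := by
  ext β
  constructor
  · intro hβ z hz
    have h1 : α * (z / α) = z := by field_simp
    have h2 := hβ (z / α) ((h _).mpr (by rwa [h1]))
    rw [h] at h2
    convert h2 using 1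
    field_simp
  · intro hβ z hz
    have h2 := hβ _ ((h z).mp hz)
    rw [h]
    convert h2 using 1
    ring

lemma mulRing_eq_of_addEquiv {L L' : PeriodPair} (e : Curve L ≃+ Curve L') (he : IsHolomorphic e) :
    mulRing L = mulRing L' := by
  obtain ⟨α, hα⟩ := exists_apply_eq_toCurve_mul e.toAddMonoidHom he
  have h : ∀ z, z ∈ L.lattice ↔ α * z ∈ L'.lattice := fun z => by
    rw [← toCurve_eq_zero_iff, ← toCurve_eq_zero_iff, ← hα]
    exact (EmbeddingLike.map_eq_zero_iff (f := e)).symm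
  refine mulRing_eq_of_homothety ?_ h
  rintro rfl
  have h1 : ∀ z, 1 * z ∈ L.lattice := fun z => by
    rw [h, zero_mul]
    exact zero_mem _
  exact one_ne_zero (eq_zero_of_forall_mul_mem h1)

/-! ### Multiplier rings of ℤτ + ℤ and binary quadratic forms -/

lemma mem_lattice_periods {τ : UpperHalfPlane} {z : ℂ} :
    z ∈ (periods τ).lattice ↔ ∃ m n : ℤ, (m : ℂ) * τ + n = z := by
  rw [PeriodPair.mem_lattice]
  simp [periods]

lemma intCast_mul_add_eq_zero {τ : UpperHalfPlane} {m n : ℤ} (h : (m : ℂ) * τ + n = 0) :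
    m = 0 ∧ n = 0 := by
  have him := congrArg Complex.im h
  have hm : m = 0 := by simpa [τ.im_ne_zero] using him
  subst hm
  exact ⟨rfl, by simpa using h⟩

/-- The integral binary quadratic form of `τ`, when the lattice `ℤ τ + ℤ` has complex
multiplication by the quadratic order of discriminant `D`. -/
theorem exists_form_of_equiv {D : ℤ} (hD : D % 4 = 0 ∨ D % 4 = 1) {τ : UpperHalfPlane}
    (e : QuadraticOrder D ≃+* mulRing (periods τ)) :
    ∃ a b c : ℤ, (a : ℂ) * τ ^ 2 + b * τ + c = 0 ∧ b ^ 2 - 4 * a * c = D ∧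
      ∀ p : ℕ, p.Prime → (p : ℤ) ∣ a → (p : ℤ) ∣ b → ¬ (p : ℤ) ∣ c := by
  set ω : ℂ := ((e ⟨0, 1⟩ : mulRing (periods τ)) : ℂ) with hω
  have hmem : ∀ z ∈ (periods τ).lattice, ω * z ∈ (periods τ).lattice := (e ⟨0, 1⟩).2
  have hsq : ω * ω = ((D / 4 : ℤ) : ℂ) + ((D % 4 : ℤ) : ℂ) * ω := by
    have h1 : (⟨0, 1⟩ : QuadraticOrder D) * ⟨0, 1⟩ =
        ((D / 4 : ℤ) : QuadraticOrder D) + ((D % 4 : ℤ) : QuadraticOrder D) * ⟨0, 1⟩ := by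
      ext <;> simp
    have h2 := congrArg (fun z => ((e z : mulRing (periods τ)) : ℂ)) h1
    simpa only [map_mul, map_add, map_intCast, Subring.coe_mul, Subring.coe_add,
      Subring.coe_intCast] using h2
  obtain ⟨p, q, hpq⟩ := mem_lattice_periods.mp (hmem 1 (mem_lattice_periods.mpr ⟨0, 1, by simp⟩))
  obtain ⟨s, t, hst⟩ := mem_lattice_periods.mp (hmem τ (mem_lattice_periods.mpr ⟨1, 0, by simp⟩))
  rw [mul_one] at hpq
  have hp : p ≠ 0 := by
    rintro rfl
    have h1 : e ⟨0, 1⟩ = e (q : QuadraticOrder D) := by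
      apply Subtype.ext
      rw [map_intCast, Subring.coe_intCast, ← hω, ← hpq]
      simp
    have h2 := congrArg QuadraticAlgebra.im (e.injective h1)
    simp at h2
  -- The quadratic equation of ω, applied to the basis vector 1, yields the trace and norm of its
  -- matrix on (τ, 1).
  have h1 := intCast_mul_add_eq_zero (τ := τ) (m := p * (s + q) - D % 4 * p)
    (n := p * t + q ^ 2 - D / 4 - D % 4 * q) (by
      push_cast at hsq ⊢
      linear_combination hsq + (p : ℂ) * hst + (ω + q - ((D % 4 : ℤ) : ℂ)) * hpq)
  have htr : s + q = D % 4 := mul_left_cancel₀ hp (by linear_combination h1.1)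
  have hnorm : p * t = D / 4 + s * q := by linear_combination h1.2 - q * htr
  have hr : (D % 4) ^ 2 = D % 4 := by rcases hD with h | h <;> rw [h] <;> rfl
  have hdiv := Int.mul_ediv_add_emod D 4
  refine ⟨p, q - s, -t, ?_, ?_, fun l hl ⟨p', hp'⟩ ⟨q', hq'⟩ ht => ?_⟩
  · push_cast
    linear_combination (τ : ℂ) * hpq - hst
  · linear_combination hdiv + hr + 4 * hnorm + (s + q + D % 4) * htr
  · obtain ⟨t', ht'⟩ := (dvd_neg).mp ht
    have hl0 : (l : ℂ) ≠ 0 := by exact_mod_cast hl.ne_zero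
    have e1 : (p : ℂ) = l * p' := by exact_mod_cast congrArg (Int.cast : ℤ → ℂ) hp'
    have e2 : (q : ℂ) - s = l * q' := by exact_mod_cast congrArg (Int.cast : ℤ → ℂ) hq'
    have e3 : (t : ℂ) = l * t' := by exact_mod_cast congrArg (Int.cast : ℤ → ℂ) ht'
    have hτ : ((p' : ℂ) * τ + q') * τ = t' := by
      apply mul_left_cancel₀ hl0
      linear_combination (τ : ℂ) * hpq - hst - τ ^ 2 * e1 - τ * e2 + e3
    -- This number is (ω - s)/l; it preserves the lattice yet does not lie in ℤ[ω].
    have hθ : (p' : ℂ) * τ + q' ∈ mulRing (periods τ) := by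
      intro z hz
      obtain ⟨m, k, rfl⟩ := mem_lattice_periods.mp hz
      refine mem_lattice_periods.mpr ⟨k * p', m * t' + k * q', ?_⟩
      push_cast
      linear_combination -(m : ℂ) * hτ
    obtain ⟨w, hw⟩ := e.surjective ⟨_, hθ⟩
    have h2 : e ((l : ℤ) * w) = e (⟨0, 1⟩ - (s : QuadraticOrder D)) := by
      apply Subtype.ext
      rw [map_mul, map_sub, map_intCast, map_intCast, hw, Subring.coe_mul,
        AddSubgroupClass.coe_sub, ← hω,
        Subring.coe_intCast, Subring.coe_intCast, ← hpq]
      push_cast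
      linear_combination -τ * e1 - e2
    have h3 := congrArg QuadraticAlgebra.im (e.injective h2)
    simp at h3
    have h4 : (l : ℤ) ∣ 1 := ⟨_, h3.symm⟩
    exact (Nat.prime_iff_prime_int.mp hl).not_isUnit (isUnit_of_dvd_one h4)

lemma exists_two_mul_eq_add {b D k : ℤ} (h : b ^ 2 - 4 * k = D) : ∃ s, 2 * s = b + D % 4 := by
  have h1 : Even (b * (b - 1)) := Int.even_mul_pred_self b
  obtain ⟨t, ht⟩ := h1
  have h2 := Int.mul_ediv_add_emod D 4
  refine ⟨b + t - 2 * k - 2 * (D / 4), ?_⟩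
  linear_combination h - h2 - ht

/-- The generator is aτ + s with 2s = b + D % 4, which has trace D % 4. Any multiplier is uτ + v,
and a divides ub and uc; primitivity of (a, b, c) then gives a ∣ u. -/
theorem exists_equiv_of_form {D : ℤ} (hD : D % 4 = 0 ∨ D % 4 = 1) {τ : UpperHalfPlane}
    {a b c : ℤ} (hτ : (a : ℂ) * τ ^ 2 + b * τ + c = 0) (hdisc : b ^ 2 - 4 * a * c = D)
    (hprim : ∀ p : ℕ, p.Prime → (p : ℤ) ∣ a → (p : ℤ) ∣ b → ¬ (p : ℤ) ∣ c) :
    Nonempty (endRing (periods τ) ≃+* QuadraticOrder D) := by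
  obtain ⟨s, hs⟩ := exists_two_mul_eq_add (b := b) (D := D) (k := a * c) (by rw [← hdisc]; ring)
  have hr : (D % 4) ^ 2 = D % 4 := by rcases hD with h | h <;> rw [h] <;> rfl
  have hdiv := Int.mul_ediv_add_emod D 4
  have ha : a ≠ 0 := by
    rintro rfl
    obtain ⟨rfl, rfl⟩ := intCast_mul_add_eq_zero (τ := τ) (m := b) (n := c) (by simpa using hτ)
    exact hprim 2 Nat.prime_two (dvd_zero _) (dvd_zero _) (dvd_zero _)
  have hω : (a : ℂ) * τ + s ∈ mulRing (periods τ) := by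
    intro z hz
    obtain ⟨m, k, rfl⟩ := mem_lattice_periods.mp hz
    refine mem_lattice_periods.mpr ⟨m * (s - b) + k * a, k * s - m * c, ?_⟩
    push_cast
    linear_combination -(m : ℂ) * hτ
  have hnorm : s ^ 2 - D % 4 * s - D / 4 = a * c := by
    have h4 : 4 * (s ^ 2 - D % 4 * s - D / 4) = 4 * (a * c) := by
      linear_combination (2 * s + b - D % 4) * hs + hdisc - hr - hdiv
    linarith
  have hs' : (2 : ℂ) * s = b + (D % 4 : ℤ) := by exact_mod_cast congrArg (Int.cast : ℤ → ℂ) hs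
  have hnorm' : (s : ℂ) ^ 2 - (D % 4 : ℤ) * s - (D / 4 : ℤ) = a * c := by
    exact_mod_cast congrArg (Int.cast : ℤ → ℂ) hnorm
  let ω : mulRing (periods τ) := ⟨_, hω⟩
  have hsq : ω * ω = (D / 4) • (1 : mulRing (periods τ)) + (D % 4) • ω := by
    apply Subtype.ext
    simp only [zsmul_eq_mul, mul_one, Subring.coe_mul, Subring.coe_add, Subring.coe_intCast, ω]
    linear_combination (a : ℂ) * hτ + a * τ * hs' + hnorm'
  let f : QuadraticOrder D →ₐ[ℤ] mulRing (periods τ) := QuadraticAlgebra.lift ⟨ω, hsq⟩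
  have hf : ∀ z, (f z : ℂ) = (z.im * a : ℤ) * τ + (z.re + z.im * s : ℤ) := by
    intro z
    simp only [f, QuadraticAlgebra.lift, Equiv.coe_fn_mk, AlgHom.coe_mk, RingHom.coe_mk,
      MonoidHom.coe_mk, OneHom.coe_mk, zsmul_eq_mul, Subring.coe_mul, Subring.coe_add,
      Subring.coe_intCast, mul_one, ω]
    push_cast
    ring
  have hbij : Function.Bijective f := by
    constructor
    · rw [injective_iff_map_eq_zero]
      intro z hz
      have h1 : (f z : ℂ) = 0 := by rw [hz]; rfl
      rw [hf] at h1
      obtain ⟨h2, h3⟩ := intCast_mul_add_eq_zero h1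
      have h4 : z.im = 0 := (mul_eq_zero.mp h2).resolve_right ha
      rw [h4, zero_mul, add_zero] at h3
      exact QuadraticAlgebra.ext h3 h4
    · rintro ⟨α, hα⟩
      obtain ⟨u, v, huv⟩ := mem_lattice_periods.mp
        (hα 1 (mem_lattice_periods.mpr ⟨0, 1, by simp⟩))
      obtain ⟨x, y, hxy⟩ := mem_lattice_periods.mp
        (hα τ (mem_lattice_periods.mpr ⟨1, 0, by simp⟩))
      rw [mul_one] at huv
      obtain ⟨h1, h2⟩ := intCast_mul_add_eq_zero (τ := τ) (m := a * v - u * b - a * x)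
        (n := -u * c - a * y) (by
          push_cast
          linear_combination (a : ℂ) * τ * huv - a * hxy - u * hτ)
      obtain ⟨k₁, k₂, k₃, hk⟩ := exists_bezout_of_forall_prime hprim
      have h3 : u = a * (k₁ * u + k₂ * (v - x) - k₃ * y) := by
        linear_combination -u * hk - k₂ * h1 - k₃ * h2
      set u' := k₁ * u + k₂ * (v - x) - k₃ * y
      refine ⟨⟨v - u' * s, u'⟩, Subtype.ext ?_⟩
      rw [hf]
      change _ = α
      rw [← huv, h3]
      push_cast
      ring
  exact ⟨(endRingEquiv _).symm.trans (RingEquiv.ofBijective f hbij).symm⟩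

/-! ### The isogeny from τ to Nτ, and Heegner points -/

/-- The point `N τ` of the upper half plane. -/
def natMul (N : ℕ) (hN : N ≠ 0) (τ : UpperHalfPlane) : UpperHalfPlane :=
  ⟨N * τ, by
    have h1 : 0 < (N : ℝ) := by positivity
    simpa using mul_pos h1 τ.im_pos⟩

lemma coe_natMul (N : ℕ) (hN : N ≠ 0) (τ : UpperHalfPlane) : (natMul N hN τ : ℂ) = N * τ := rfl

lemma toCurve_mem_zmultiples_iff {N : ℕ} (hN : N ≠ 0) {τ : UpperHalfPlane} {z : ℂ} :
    toCurve (periods τ) z ∈ AddSubgroup.zmultiples (toCurve (periods τ) (1 / (N : ℂ))) ↔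
      N * z ∈ (periods (natMul N hN τ)).lattice := by
  have hN0 : (N : ℂ) ≠ 0 := by exact_mod_cast hN
  rw [AddSubgroup.mem_zmultiples_iff, mem_lattice_periods]
  constructor
  · rintro ⟨k, hk⟩
    change toCurve (periods τ) (k • (1 / (N : ℂ))) = _ at hk
    rw [← sub_eq_zero, toCurve, toCurve, ← Submodule.Quotient.mk_sub] at hk
    obtain ⟨m, n, h⟩ := mem_lattice_periods.mp (toCurve_eq_zero_iff.mp hk)
    refine ⟨-m, k - N * n, ?_⟩
    rw [zsmul_eq_mul] at h
    rw [coe_natMul]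
    have h1 : (N : ℂ) * (m * τ + n) = k - N * z := by
      rw [h]
      field_simp
    push_cast
    linear_combination -h1
  · rintro ⟨m, n, h⟩
    refine ⟨n, ?_⟩
    change toCurve (periods τ) (n • (1 / (N : ℂ))) = _
    rw [← sub_eq_zero, toCurve, toCurve, ← Submodule.Quotient.mk_sub]
    refine toCurve_eq_zero_iff.mpr (mem_lattice_periods.mpr ⟨-m, 0, ?_⟩)
    rw [coe_natMul] at h
    rw [zsmul_eq_mul]
    apply mul_left_cancel₀ hN0
    field_simp
    push_cast
    linear_combination -h

/-- The cyclic isogeny of degree `N` induced by multiplication by `N`, from `ℂ / (ℤ τ + ℤ)`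
to `ℂ / (ℤ N τ + ℤ)`. -/
lemma exists_cyclicIsogeny (N : ℕ) (hN : N ≠ 0) (τ : UpperHalfPlane) :
    ∃ φ : CyclicIsogeny N (periods τ) (periods (natMul N hN τ)),
      φ.toHom.ker = AddSubgroup.zmultiples (toCurve (periods τ) (1 / (N : ℂ))) := by
  have hN0 : (N : ℂ) ≠ 0 := by exact_mod_cast hN
  have hmul : ∀ z ∈ (periods τ).lattice, (N : ℂ) * z ∈ (periods (natMul N hN τ)).lattice := by
    intro z hz
    rw [← toCurve_mem_zmultiples_iff, toCurve_eq_zero_iff.mpr hz]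
    exact zero_mem _
  have hker : (mulHom (N : ℂ) hmul).ker =
      AddSubgroup.zmultiples (toCurve (periods τ) (1 / (N : ℂ))) := by
    ext x
    obtain ⟨z, rfl⟩ := toCurve_surjective _ x
    rw [toCurve_mem_zmultiples_iff hN, AddMonoidHom.mem_ker, mulHom_apply, toCurve_eq_zero_iff]
  refine ⟨⟨mulHom N hmul, isHolomorphic_mulHom hmul, fun h0 => ?_, ?_, ?_⟩, hker⟩
  · refine hN0 (eq_zero_of_forall_mul_mem (L := periods (natMul N hN τ)) fun z => ?_)
    rw [← toCurve_eq_zero_iff, ← mulHom_apply hmul, h0]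
    rfl
  · rw [hker]
    infer_instance
  · rw [hker, Nat.card_zmultiples]
    have h1 : ∀ k : ℕ, k • toCurve (periods τ) (1 / (N : ℂ)) = 0 ↔ N ∣ k := by
      intro k
      change toCurve (periods τ) (k • (1 / (N : ℂ))) = 0 ↔ _
      rw [toCurve_eq_zero_iff, mem_lattice_periods, nsmul_eq_mul]
      constructor
      · rintro ⟨m, n, h⟩
        have h2 : ((N * m : ℤ) : ℂ) * τ + ((N * n - k : ℤ) : ℂ) = 0 := by
          have h3 : (N : ℂ) * (m * τ + n) = k := by
            rw [h]
            field_simp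
          push_cast
          linear_combination h3
        obtain ⟨-, h3⟩ := intCast_mul_add_eq_zero h2
        exact Int.natCast_dvd_natCast.mp ⟨n, by linarith⟩
      · rintro ⟨n, rfl⟩
        refine ⟨0, n, ?_⟩
        push_cast
        field_simp
        simp
    exact Nat.dvd_antisymm (addOrderOf_dvd_iff_nsmul_eq_zero.mpr ((h1 N).mpr dvd_rfl))
      ((h1 _).mp (addOrderOf_nsmul_eq_zero _))

/-- The kernel determines the target up to homothety: φ becomes multiplication by α with the same
kernel as multiplication by N, so α/N carries the lattice of Nτ onto that of L'. -/
lemma mulRing_eq_of_cyclicIsogeny {N : ℕ} (hN : N ≠ 0) {L L' : PeriodPair} {τ : UpperHalfPlane}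
    (φ : CyclicIsogeny N L L') (e : Curve L ≃+ Curve (periods τ)) (he : IsHolomorphic e.symm)
    (hker : φ.toHom.ker.map e.toAddMonoidHom =
      AddSubgroup.zmultiples (toCurve (periods τ) (1 / (N : ℂ)))) :
    mulRing (periods (natMul N hN τ)) = mulRing L' := by
  have hN0 : (N : ℂ) ≠ 0 := by exact_mod_cast hN
  let ψ : Curve (periods τ) →+ Curve L' := φ.toHom.comp e.symm.toAddMonoidHom
  obtain ⟨α, hα⟩ := exists_apply_eq_toCurve_mul ψ (φ.holomorphic.comp he)
  have hα0 : α ≠ 0 := by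
    rintro rfl
    refine φ.ne_zero (AddMonoidHom.ext fun x => ?_)
    obtain ⟨z, hz⟩ := toCurve_surjective _ (e x)
    have h1 := hα z
    rw [hz, zero_mul] at h1
    simpa [ψ] using h1
  have hψ : ∀ z, α * z ∈ L'.lattice ↔ N * z ∈ (periods (natMul N hN τ)).lattice := by
    intro z
    rw [← toCurve_mem_zmultiples_iff hN, ← hker, ← toCurve_eq_zero_iff, ← hα]
    constructor
    · intro h
      exact ⟨e.symm (toCurve (periods τ) z), h, e.apply_symm_apply _⟩
    · rintro ⟨x, hx, hxz⟩
      have h1 : e.symm (toCurve (periods τ) z) = x := by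
        rw [← hxz]
        exact e.symm_apply_apply x
      change φ.toHom (e.symm (toCurve (periods τ) z)) = 0
      rw [h1]
      exact hx
  refine mulRing_eq_of_homothety (α := α / N) (div_ne_zero hα0 hN0) fun z => ?_
  have h1 := (hψ (z / N)).symm
  rw [mul_div_cancel₀ _ hN0] at h1
  rw [h1]
  congr! 1
  ring

theorem hasPrimitiveRoot_of_isHeegnerPoint {N : ℕ} (hN : N ≠ 0) {D : ℤ} (hD0 : D ≠ 0)
    (hD : D % 4 = 0 ∨ D % 4 = 1) {P : Y0 N} (hP : IsHeegnerPoint N D P) : HasPrimitiveRoot N D := by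
  obtain ⟨L, L', φ, ⟨τ, -, e, he, he', hker⟩, ⟨E⟩, ⟨E'⟩⟩ := hP
  have hL := mulRing_eq_of_addEquiv e he
  have hL' := mulRing_eq_of_cyclicIsogeny hN φ e he' hker
  obtain ⟨a, b, c, hτ, hdisc, hprim⟩ := exists_form_of_equiv hD (τ := τ)
    (E.symm.trans ((endRingEquiv L).symm.trans (RingEquiv.subringCongr hL)))
  obtain ⟨a₁, b₁, c₁, hτ₁, hdisc₁, hprim₁⟩ := exists_form_of_equiv hD (τ := natMul N hN τ)
    (E'.symm.trans ((endRingEquiv L').symm.trans (RingEquiv.subringCongr hL'.symm)))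
  rw [coe_natMul] at hτ₁
  have hN0 : (N : ℤ) ≠ 0 := by exact_mod_cast hN
  have ha₁ : a₁ ≠ 0 := by
    rintro rfl
    obtain ⟨h1, rfl⟩ := intCast_mul_add_eq_zero (τ := τ) (m := b₁ * N) (n := c₁) (by
      push_cast
      linear_combination hτ₁)
    obtain rfl := (mul_eq_zero.mp h1).resolve_right hN0
    exact hprim₁ 2 Nat.prime_two (dvd_zero _) (dvd_zero _) (dvd_zero _)
  -- Eliminating τ² shows (a₁N², b₁N, c₁) proportional to (a, b, c); their discriminants DN² and D,
  -- with D ≠ 0, then fix the ratio up to sign.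
  obtain ⟨h1, h2⟩ := intCast_mul_add_eq_zero (τ := τ) (m := N * (a * b₁ - a₁ * N * b))
    (n := a * c₁ - a₁ * N ^ 2 * c) (by
      push_cast
      linear_combination (a : ℂ) * hτ₁ - a₁ * N ^ 2 * hτ)
  have h3 : a * b₁ = a₁ * N * b := by
    have := (mul_eq_zero.mp h1).resolve_left hN0
    linarith
  have h4 : a ^ 2 = (a₁ * N) ^ 2 := by
    apply mul_right_cancel₀ hD0
    linear_combination -a ^ 2 * hdisc₁ + (a₁ * N) ^ 2 * hdisc + (a * b₁ + a₁ * N * b) * h3 -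
      4 * a₁ * a * h2
  obtain ⟨ε, hε, haε⟩ : ∃ ε : ℤ, ε * ε = 1 ∧ a = ε * (a₁ * N) := by
    rcases sq_eq_sq_iff_eq_or_eq_neg.mp h4 with h | h
    · exact ⟨1, rfl, by rw [h, one_mul]⟩
    · exact ⟨-1, rfl, by rw [h, neg_one_mul]⟩
  have hne : a₁ * N ≠ 0 := mul_ne_zero ha₁ hN0
  have hb : b₁ = ε * b := by
    apply mul_left_cancel₀ hne
    linear_combination ε * h3 - ε * b₁ * haε - a₁ * N * b₁ * hε
  have hc : c₁ = ε * N * c := by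
    apply mul_left_cancel₀ hne
    linear_combination ε * h2 - ε * c₁ * haε - a₁ * N * c₁ * hε
  obtain ⟨x, hx⟩ := exists_two_mul_eq_add (b := b) (D := D) (k := a * c) (by rw [← hdisc]; ring)
  have hxb : 2 * x - D % 4 = b := by linarith
  -- A common prime of N, b and εa₁c divides a₁ or c, contradicting primitivity of the form of Nτ or
  -- of τ respectively.
  refine ⟨x, ε * a₁ * c, ?_, fun p hp hpN hpb hpg => ?_⟩
  · have h5 := four_mul_omegaPoly hD x
    rw [hxb] at h5
    have h6 : 4 * omegaPoly D x = 4 * (N * (ε * a₁ * c)) := by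
      linear_combination h5 + hdisc + 4 * c * haε
    linarith
  · have hpp := Nat.prime_iff_prime_int.mp hp
    rw [hxb] at hpb
    rcases hpp.dvd_or_dvd hpg with h | h
    · rcases hpp.dvd_or_dvd h with h' | h'
      · exact hpp.not_isUnit (isUnit_of_dvd_one (hε ▸ dvd_mul_of_dvd_left h' ε))
      · exact hprim₁ p hp h' (hb ▸ dvd_mul_of_dvd_right hpb _)
          (hc ▸ dvd_mul_of_dvd_left (dvd_mul_of_dvd_right hpN _) _)
    · exact hprim p hp (haε ▸ dvd_mul_of_dvd_right (dvd_mul_of_dvd_right hpN _) _) hpb h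

theorem exists_isHeegnerPoint_of_hasPrimitiveRoot {N : ℕ} (hN : N ≠ 0) {D : ℤ} (hD0 : D < 0)
    (hD : D % 4 = 0 ∨ D % 4 = 1) (h : HasPrimitiveRoot N D) :
    ∃ P : Y0 N, IsHeegnerPoint N D P := by
  obtain ⟨x, g, hg, hprim⟩ := h
  have h4 := four_mul_omegaPoly hD x
  set b := 2 * x - D % 4
  have hdisc : b ^ 2 - 4 * N * g = D := by linear_combination -h4 + 4 * hg
  have hN0 : (N : ℂ) ≠ 0 := by exact_mod_cast hN
  have hNpos : (0 : ℝ) < N := by positivity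
  have hDpos : (0 : ℝ) < -D := by
    have : (D : ℝ) < 0 := by exact_mod_cast hD0
    linarith
  -- The root of (N, b, g) in the upper half plane; Nτ is then a root of (1, b, Ng), of the same
  -- discriminant.
  let τ : UpperHalfPlane := ⟨(-b + Real.sqrt (-D) * Complex.I) / (2 * N), by
    have h1 : ((-b + Real.sqrt (-D) * Complex.I) / (2 * N) : ℂ) =
        ((-b / (2 * N) : ℝ) : ℂ) + ((Real.sqrt (-D) / (2 * N) : ℝ) : ℂ) * Complex.I := by
      push_cast
      ring
    rw [h1, Complex.add_im, Complex.ofReal_im, Complex.im_ofReal_mul, Complex.I_im]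
    have := Real.sqrt_pos.mpr hDpos
    positivity⟩
  have hτ0 : (τ : ℂ) = (-b + Real.sqrt (-D) * Complex.I) / (2 * N) := rfl
  have hτ : (N : ℂ) * τ ^ 2 + b * τ + g = 0 := by
    have h1 : ((Real.sqrt (-D) : ℝ) : ℂ) ^ 2 = -D := by
      rw [← Complex.ofReal_pow, Real.sq_sqrt hDpos.le]
      push_cast
      rfl
    have h2 : (b : ℂ) ^ 2 - 4 * N * g = D := by exact_mod_cast congrArg (Int.cast : ℤ → ℂ) hdisc
    rw [hτ0]
    field_simp
    linear_combination -h2 + Complex.I ^ 2 * h1 - (D : ℂ) * Complex.I_sq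
  obtain ⟨φ, hφ⟩ := exists_cyclicIsogeny N hN τ
  refine ⟨Quotient.mk _ τ, periods τ, periods (natMul N hN τ), φ,
    ⟨τ, rfl, AddEquiv.refl _, IsHolomorphic.id _, IsHolomorphic.id _, ?_⟩,
    exists_equiv_of_form (a := N) (b := b) (c := g) hD (by exact_mod_cast hτ) hdisc hprim,
    exists_equiv_of_form (a := 1) (b := b) (c := N * g) hD ?_ (by rw [← hdisc]; ring)
      fun p hp h1 => absurd h1 fun h1 =>
        (Nat.prime_iff_prime_int.mp hp).not_isUnit (isUnit_of_dvd_one h1)⟩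
  · rw [hφ]
    exact AddSubgroup.map_id _
  · rw [coe_natMul]
    push_cast
    linear_combination (N : ℂ) * hτ

end

/-! ### The splitting condition and the conclusion -/

theorem hasPrimitiveRoot_iff_split {K : Type*} [Field K] [NumberField K]
    [Algebra.IsQuadraticExtension ℚ K] {D c : ℤ} (hD : D % 4 = 0 ∨ D % 4 = 1)
    (h : D = NumberField.discr K * c ^ 2) {B : ℕ} (hB : B ≠ 0)
    (hBc : ∀ p : ℕ, p.Prime → p ∣ B → ¬ (p : ℤ) ∣ c) :
    HasPrimitiveRoot B D ↔ ∀ p : ℕ, p.Prime → p ∣ B →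
      (SplitIn p K ∨ RamifiedIn p K) ∧ (p ^ 2 ∣ B → SplitIn p K) := by
  obtain ⟨hDK, ⟨e⟩⟩ := exists_ringEquiv_quadraticOrder (R := NumberField.RingOfIntegers K)
    (by rw [NumberField.RingOfIntegers.rank, Algebra.IsQuadraticExtension.finrank_eq_two ℚ K])
  rw [ringDiscr_ringOfIntegers] at hDK e
  rw [hasPrimitiveRoot_iff_forall_prime hB]
  refine forall_congr' fun p => forall_congr' fun hp => forall_congr' fun hpB => ?_
  have hk : 1 ≤ B.factorization p := (hp.dvd_iff_one_le_factorization hB).mp hpB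
  obtain ⟨k, hk'⟩ := Nat.exists_eq_add_of_le' hk
  rw [hk', hasPrimitiveRoot_prime_pow_iff hDK hD h hp (hBc p hp hpB) (not_sq_dvd_omegaPoly e hp),
    splitIn_or_ramifiedIn_iff e hp, splitIn_iff e hp, hp.pow_dvd_iff_le_factorization hB, hk']
  refine and_congr_right fun _ => imp_congr_left ?_
  omega

end Heegner

theorem mainTheorem12 (K : Type*) [Field K] [NumberField K] [Algebra.IsQuadraticExtension ℚ K]
    [NumberField.IsTotallyComplex K] (O : Subring K) [Heegner.IsOrder O] (D : ℤ) (c : ℕ)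
    (hO : Heegner.ringDiscr O = D) (hD : D = NumberField.discr K * (c : ℤ) ^ 2)
    (N m Nm Nm' : ℕ) (hN : 1 ≤ N) (hm : m = Nat.gcd N c) (hNm : Nm = Heegner.levelPart N m)
    (hNm' : Nm' = N / Nm) :
    (∃ P : Heegner.Y0 N, Heegner.IsHeegnerPoint N D P) ↔
      (∀ p : ℕ, p.Prime → p ∣ Nm' →
        (Heegner.SplitIn p K ∨ Heegner.RamifiedIn p K) ∧ (p ^ 2 ∣ N → Heegner.SplitIn p K)) ∧
      ∃ η : Ideal O, Heegner.IsAdmissible Nm η := by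
  have hN0 : N ≠ 0 := by omega
  obtain ⟨hD4, ⟨e⟩⟩ := Heegner.exists_ringEquiv_quadraticOrder (Heegner.finrank_of_isOrder K O)
  rw [hO] at hD4 e
  have hc : c ≠ 0 := by
    rintro rfl
    rw [Nat.cast_zero, zero_pow two_ne_zero, mul_zero] at hD
    subst hD
    exact Heegner.not_isDomain_quadraticOrder_zero (e.symm.toMulEquiv.isDomain _)
  have hDneg : D < 0 := by
    rw [hD]
    exact mul_neg_of_neg_of_pos (Heegner.discr_neg K) (by positivity)
  obtain ⟨B, hB, hcop, hBm⟩ := Heegner.exists_levelPart_mul hN0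
    (hm ▸ Nat.gcd_dvd_left N c : m ∣ N)
  rw [← hNm] at hB hcop
  have hNm0 : Nm ≠ 0 := fun h => hN0 (by rw [← hB, h, zero_mul])
  have hB0 : B ≠ 0 := fun h => hN0 (by rw [← hB, h, mul_zero])
  obtain rfl : Nm' = B := by
    rw [hNm', ← hB, Nat.mul_div_cancel_left _ (Nat.pos_of_ne_zero hNm0)]
  have hBc : ∀ p : ℕ, p.Prime → p ∣ Nm' → ¬ (p : ℤ) ∣ c := fun p hp hpB hpc =>
    hBm p hp hpB (hm ▸ Nat.dvd_gcd (hB ▸ dvd_mul_of_dvd_right hpB _)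
      (Int.natCast_dvd_natCast.mp hpc))
  have hheeg : (∃ P : Heegner.Y0 N, Heegner.IsHeegnerPoint N D P) ↔
      Heegner.HasPrimitiveRoot N D :=
    ⟨fun ⟨_, hP⟩ => Heegner.hasPrimitiveRoot_of_isHeegnerPoint hN0 hDneg.ne hD4 hP,
      Heegner.exists_isHeegnerPoint_of_hasPrimitiveRoot hN0 hDneg hD4⟩
  rw [hheeg, Heegner.exists_isAdmissible_iff e hNm0, ← hB, Nat.cast_mul,
    Heegner.hasPrimitiveRoot_mul_iff (Nat.isCoprime_iff_coprime.mpr hcop)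
      (by exact_mod_cast hNm0) (by exact_mod_cast hB0),
    Heegner.hasPrimitiveRoot_iff_split hD4 hD hB0 hBc, and_comm]
  -- For p ∣ N'_m, p is prime to N_m, so p² ∣ N and p² ∣ N'_m are equivalent.
  refine and_congr_left fun _ => forall_congr' fun p => forall_congr' fun hp =>
    forall_congr' fun hpB => and_congr_right fun _ => imp_congr_left ?_
  have hpNm : Nat.Coprime (p ^ 2) Nm :=
    (Nat.Coprime.coprime_dvd_left hpB hcop.symm).pow_left 2
  exact hpNm.dvd_mul_left.symm
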